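/- Let $n\in\mathbb N$, let $A:\mathbb R^n\to\mathbb R^{n\times n}$ be smooth and $\mathbb Z^n$-periodic with $A(x)$ symmetric positive definite for every $x$, let $V:\mathbb R^n\to\mathbb R$ be smooth and $\mathbb Z^n$-periodic, and put $H(x,p)=\tfrac12\langle A(x)p,p\rangle+V(x)$. Let $c\in\mathbb R^n$ and let $u$ be a continuous $\mathbb Z^n$-periodic viscosity solution of $H(x,c+Du(x))=\alpha(c)$, where $\alpha(c)$ (Mather's function) is the unique constant for which such a solution exists; that is, $H(x,c+p)\le\alpha(c)$ for all $p\in D^+u(x)$ and $H(x,c+p)\ge\alpha(c)$ for all $p\in D^-u(x)$, where $D^{+}u(x)$ (resp. $D^-u(x)$) is the set of $p\in\mathbb R^n$ with $\limsup_{y\to x}\frac{u(y)-u(x)-\langle p,y-x\rangle}{|y-x|}\le 0$ (resp. $\liminf_{y\to x}\frac{u(y)-u(x)-\langle p,y-x\rangle}{|y-x|}\ge 0$). Assume the supercritical energy condition $\alpha(c)>\max V$. Set $v(x)=u(x)+\langle c,x\rangle$ for $x\in\mathbb R^n$, let $\Sigma_v$ be the set of points $x$ at which $D^+v(x)$ is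 not a singleton, and let $\Lambda_x=\{y\in\mathbb R^n: v(y)=v(x)\}$. A generalized characteristic on $[0,\tau]$ is a Lipschitz arc $\mathbf x:[0,\tau]\to\mathbb R^n$ such that $\dot{\mathbf x}(s)\in\mathrm{co}\,H_p(\mathbf x(s),D^+v(\mathbf x(s)))$ for a.e. $s\in[0,\tau]$, where $\mathrm{co}$ denotes the closed convex hull; it is singular if $\mathbf x(s)\in\Sigma_v$ for all $s\in[0,\tau]$. Its right derivative at $s\in[0,\tau)$ is denoted $\dot{\mathbf x}^+(s)$. A set $S$ is an $(n-1)$-dimensional Lipschitz manifold near $x\in S$ if there are an invertible linear map $T:\mathbb R^n\to\mathbb R^{n-1}\times\mathbb R$, a Lipschitz function $f:\mathbb R^{n-1}\to\mathbb R$ and a neighbourhood $U$ of $x$ such that $S\cap U=U\cap T^{-1}(\operatorname{graph} f)$. (1) If $\mathbf x:[0,\tau]\to\mathbb R^n$ is a generalized characteristic whose right derivative vanishes at no $s\in[0,\tau)$, then $$v(\mathbf x(s_1))<v(\mathbf x(s_2))\qquad\text{for all }0\le s_1<s_2\le\tau .$$ (2) If $x\in\Sigma_v$ is not a local maximum point of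 $v$ and $\Lambda_x$ is an $(n-1)$-dimensional Lipschitz manifold near $x$, then there are $\tau'>0$ and a singular generalized characteristic $\mathbf x:[0,\tau']\to\mathbb R^n$ with $\mathbf x(0)=x$ such that $\dot{\mathbf x}^+(s)$ exists and $\dot{\mathbf x}^+(s)\ne0$ for all $s\in[0,\tau')$. In particular, $\mathbf x$ is not constant. -/

import Mathlib

open Set Filter Topology MeasureTheory
open scoped ContDiff

/-- The Euclidean space `ℝⁿ`, the universal cover of the flat torus `𝕋ⁿ`. -/
abbrev RSpace (n : ℕ) : Type := EuclideanSpace ℝ (Fin n)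

/-- `ℤⁿ`-periodicity of a function on `ℝⁿ`. -/
def IsZPeriodic {n : ℕ} {β : Type*} (f : RSpace n → β) : Prop :=
  ∀ (x : RSpace n) (k : Fin n → ℤ), f (x + WithLp.toLp 2 (fun i => (k i : ℝ))) = f x

/-- The Dini superdifferential `D⁺u(x)`: all `p` such that
`limsup_{y → x} (u y - u x - ⟨p, y - x⟩) / |y - x| ≤ 0`. -/
def superdiff {n : ℕ} (u : RSpace n → ℝ) (x : RSpace n) : Set (RSpace n) :=
  {p | ∀ ε : ℝ, 0 < ε → ∀ᶠ y in 𝓝 x, u y - u x - inner ℝ p (y - x) ≤ ε * ‖y - x‖}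

/-- The Dini subdifferential `D⁻u(x)`: all `p` such that
`liminf_{y → x} (u y - u x - ⟨p, y - x⟩) / |y - x| ≥ 0`. -/
def subdiff {n : ℕ} (u : RSpace n → ℝ) (x : RSpace n) : Set (RSpace n) :=
  {p | ∀ ε : ℝ, 0 < ε → ∀ᶠ y in 𝓝 x, -(ε * ‖y - x‖) ≤ u y - u x - inner ℝ p (y - x)}

/-- The singular set `Σ_u`: the points at which `D⁺u` is not a singleton. -/
def singularSet {n : ℕ} (u : RSpace n → ℝ) : Set (RSpace n) :=
  {x | ¬ ∃ p, superdiff u x = {p}}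

/-- The mechanical Hamiltonian `H(x, p) = ½ ⟨A(x) p, p⟩ + V(x)`. -/
noncomputable def mechHamiltonian {n : ℕ} (A : RSpace n → Matrix (Fin n) (Fin n) ℝ)
    (V : RSpace n → ℝ) (x p : RSpace n) : ℝ :=
  (1 / 2) * inner ℝ (Matrix.toEuclideanLin (A x) p) p + V x

/-- `A` is a smooth `ℤⁿ`-periodic field of symmetric positive definite matrices. -/
structure IsPeriodicMetric {n : ℕ} (A : RSpace n → Matrix (Fin n) (Fin n) ℝ) : Prop where
  smooth : ∀ i j, ContDiff ℝ ∞ (fun x => A x i j)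
  periodic : IsZPeriodic A
  posDef : ∀ x, (A x).PosDef

/-- `V` is a smooth `ℤⁿ`-periodic function. -/
structure IsPeriodicPotential {n : ℕ} (V : RSpace n → ℝ) : Prop where
  smooth : ContDiff ℝ ∞ V
  periodic : IsZPeriodic V

/-- `u` is a (continuous) viscosity solution of `H(x, Du(x)) = E` on `ℝⁿ`. -/
structure IsViscositySolution {n : ℕ} (H : RSpace n → RSpace n → ℝ) (E : ℝ)
    (u : RSpace n → ℝ) : Prop where
  continuous : Continuous u
  subsolution : ∀ x, ∀ p ∈ superdiff u x, H x p ≤ E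
  supersolution : ∀ x, ∀ p ∈ subdiff u x, E ≤ H x p

/-- `u` is a weak KAM solution at cohomology class `c` and energy `a`: a `ℤⁿ`-periodic viscosity
solution of `H(x, c + Du(x)) = a`. The only `a` for which such a `u` exists is Mather's `α(c)`. -/
structure IsWeakKAMSolution {n : ℕ} (H : RSpace n → RSpace n → ℝ) (c : RSpace n) (a : ℝ)
    (u : RSpace n → ℝ) : Prop where
  periodic : IsZPeriodic u
  viscosity : IsViscositySolution (fun x p => H x (c + p)) a u

/-- The function `v(x) = u(x) + ⟨c, x⟩` on `ℝⁿ`. -/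
noncomputable def liftedSolution {n : ℕ} (c : RSpace n) (u : RSpace n → ℝ) : RSpace n → ℝ :=
  fun x => u x + inner ℝ c x

/-- The level set `Λ_x = {y : v y = v x}`. -/
def levelSet {n : ℕ} (v : RSpace n → ℝ) (x : RSpace n) : Set (RSpace n) :=
  {y | v y = v x}

/-- `S` is an `(n-1)`-dimensional Lipschitz submanifold of `ℝⁿ` near `x`: after an invertible
linear change of coordinates `ℝⁿ ≃ ℝⁿ⁻¹ × ℝ`, it coincides in a neighbourhood of `x` with the
graph of a Lipschitz function. -/
def IsLipschitzHypersurfaceNear {n : ℕ} (S : Set (RSpace n)) (x : RSpace n) : Prop :=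
  x ∈ S ∧ ∃ (T : RSpace n ≃ₗ[ℝ] RSpace (n - 1) × ℝ) (f : RSpace (n - 1) → ℝ),
    (∃ K, LipschitzWith K f) ∧ ∃ U ∈ 𝓝 x, ∀ y ∈ U, y ∈ S ↔ (T y).2 = f (T y).1

/-- `γ`, restricted to `[0, τ]`, is a generalized characteristic of `H(x, Dv(x)) = E`: a Lipschitz
arc with `γ'(s) ∈ co H_p(γ(s), D⁺v(γ(s)))` for almost every `s ∈ [0, τ]`, where `co` is the closed
convex hull and `H_p` is the gradient of `H` in `p`. Values of `γ` off `[0, τ]` play no role. -/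
structure IsGeneralizedCharacteristic {n : ℕ} (H : RSpace n → RSpace n → ℝ) (v : RSpace n → ℝ)
    (τ : ℝ) (γ : ℝ → RSpace n) : Prop where
  lipschitz : ∃ K, LipschitzOnWith K γ (Icc 0 τ)
  inclusion : ∀ᵐ s ∂(volume.restrict (Icc 0 τ)),
    ∃ w ∈ closure (convexHull ℝ ((fun p => gradient (H (γ s)) p) '' superdiff v (γ s))),
      HasDerivAt γ w s

/-!
Write `v = u + ⟨c, ·⟩` and `B x` for the operator of the matrix `A x`. Everything rests on two
regularity properties of `v`: it is Lipschitz (`liftedSolution_lipschitz`) and semiconcave with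
linear modulus (`exists_semiconcave_const`). Both follow from the definition of viscosity solutions
by looking at maximum points. For semiconcavity one maximises
`v x + v y - 2 v z - M √(‖x - y‖⁴ + ‖x + y - 2z‖²)`; the test gradients at a positive maximum
contradict the uniform convexity of the Hamiltonian when `M` is large. Semiconcavity turns a
supergradient into a global upper paraboloid, so that `D⁺v` has nonempty compact convex values, a
closed graph, and is monotone up to a quadratic error. In particular the closed convex hull in the
definition of generalized characteristics is just `B x (D⁺v x)`.

Monotonicity. Where a characteristic satisfies `γ' = B p` with `p ∈ D⁺v(γ)`, the chain rule gives
`(v ∘ γ)' = ⟨B p, p⟩ ≥ 0`. Hence `v ∘ γ` is nondecreasing, and on an interval where it is constant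
`γ' = 0` almost everywhere, so `γ` is constant and its right derivative vanishes
(`IsLipschitzSemiconcave.lt_along_characteristic`).

Propagation. The inclusion `γ' ∈ B(γ) D⁺v(γ)` is a gradient flow for the Riemannian metric `B⁻¹`.
* Limits of Euler polygons solve it (`IsLipschitzSemiconcave.exists_characteristic`).
* At every time the right derivative exists and equals `B p`, where `p` is the supergradient of
  least energy `⟨B p, p⟩` (`IsGradientArc.hasDerivWithinAt`).
* Comparing the arc with its own time translates shows that the least energy grows at most
  exponentially (`IsGradientArc.exists_energy_le`).
* By strict convexity a point is singular exactly when the least energy `½⟨B p, p⟩ + V` lies below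
  the level `a`. This is true at the initial point, hence persists for a short time.

Finally the right derivative does not vanish because `0 ∉ D⁺v(x)` (`zero_notMem_superdiff`), a
condition that is open in `x`. Otherwise `v ≤ v x + O(‖· - x‖²)`; as the level set is a Lipschitz
graph and `x` is not a local maximum point, `v ≥ v x` on a cone with vertex `x`. Then `v` oscillates
by `O(h²)` on balls of radius of order `h`, which gives subgradients of size `O(h)` at points near
`x`, whereas `V x < a` bounds subgradients near `x` away from `0`.
-/

/-! ### Lipschitz functions on an interval -/

/-- A Lipschitz function is nonincreasing as soon as its derivative is `≤ 0` almost everywhere: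
it is absolutely continuous, hence the integral of its derivative. -/
theorem LipschitzOnWith.le_of_ae_hasDerivAt_nonpos {f : ℝ → ℝ} {K : NNReal} {a b : ℝ}
    (hab : a ≤ b) (hf : LipschitzOnWith K f (Icc a b))
    (h : ∀ᵐ s ∂(volume.restrict (Icc a b)), ∀ d, HasDerivAt f d s → d ≤ 0) : f b ≤ f a := by
  have hac : AbsolutelyContinuousOnInterval f a b := by
    apply LipschitzOnWith.absolutelyContinuousOnInterval (K := K)
    rwa [uIcc_of_le hab]
  have h1 := hac.integral_deriv_eq_sub
  have h2 : ∫ x in a..b, deriv f x ≤ ∫ x in a..b, (0 : ℝ) := by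
    apply intervalIntegral.integral_mono_ae_restrict hab hac.intervalIntegrable_deriv
      intervalIntegrable_const
    filter_upwards [h] with s hs
    by_cases hd : DifferentiableAt ℝ f s
    · exact hs _ hd.hasDerivAt
    · rw [deriv_zero_of_not_differentiableAt hd]
  simp at h2
  linarith

/-! ### Smooth periodic functions -/

theorem norm_symmetric_second_difference_le {E F : Type*} [NormedAddCommGroup E] [NormedSpace ℝ E]
    [NormedAddCommGroup F] [NormedSpace ℝ F] {f : E → F} (hd : Differentiable ℝ f) {L : ℝ}
    (hL0 : 0 ≤ L) (hL : ∀ x y, ‖fderiv ℝ f x - fderiv ℝ f y‖ ≤ L * ‖x - y‖) (m e : E) :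
    ‖f (m + e) + f (m - e) - (2 : ℝ) • f m‖ ≤ 2 * L * ‖e‖ ^ 2 := by
  set g : E → F := fun e => f (m + e) + f (m - e) - (2 : ℝ) • f m with hg
  have hgd : ∀ e, HasFDerivAt g (fderiv ℝ f (m + e) - fderiv ℝ f (m - e)) e := by
    intro e
    have h1 : HasFDerivAt (fun e => f (m + e)) (fderiv ℝ f (m + e)) e :=
      ((hd (m + e)).hasFDerivAt.comp e ((hasFDerivAt_id e).const_add m)).congr_fderiv
        (by ext; simp)
    have h2 : HasFDerivAt (fun e => f (m - e)) (-fderiv ℝ f (m - e)) e :=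
      ((hd (m - e)).hasFDerivAt.comp e ((hasFDerivAt_id e).const_sub m)).congr_fderiv
        (by ext; simp)
    exact ((h1.add h2).sub_const ((2 : ℝ) • f m)).congr_fderiv (by abel)
  have hb : ∀ z ∈ Metric.closedBall (0 : E) ‖e‖,
      ‖fderiv ℝ f (m + z) - fderiv ℝ f (m - z)‖ ≤ 2 * L * ‖e‖ := by
    intro z hz
    refine (hL _ _).trans ?_
    have : m + z - (m - z) = (2 : ℝ) • z := by rw [two_smul]; abel
    rw [this, norm_smul, Real.norm_eq_abs, abs_two]
    have hz' : ‖z‖ ≤ ‖e‖ := by simpa using hz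
    nlinarith
  have := (convex_closedBall (0 : E) ‖e‖).norm_image_sub_le_of_norm_hasFDerivWithin_le
    (fun z _ => (hgd z).hasFDerivWithinAt) hb (Metric.mem_closedBall_self (norm_nonneg _))
    (show e ∈ Metric.closedBall (0 : E) ‖e‖ by simp)
  have hg0 : g 0 = 0 := by simp [hg, two_smul]
  rw [hg0, sub_zero, sub_zero] at this
  calc _ ≤ _ := this
    _ = _ := by ring

section Periodic

variable {n : ℕ} {F : Type*} [NormedAddCommGroup F]

theorem exists_int_translate_norm_le (x : RSpace n) :
    ∃ k : Fin n → ℤ, ‖x + WithLp.toLp 2 (fun i => (k i : ℝ))‖ ≤ √n := by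
  refine ⟨fun i => -⌊x i⌋, ?_⟩
  rw [EuclideanSpace.norm_eq]
  apply Real.sqrt_le_sqrt
  calc ∑ i, ‖(x + WithLp.toLp 2 (fun i => ((-⌊x i⌋ : ℤ) : ℝ))) i‖ ^ 2 ≤ ∑ _i : Fin n, (1 : ℝ) := by
        apply Finset.sum_le_sum
        intro i _
        have h0 := Int.fract_nonneg (x i)
        have h1 := (Int.fract_lt_one (x i)).le
        have : (x + WithLp.toLp 2 (fun i => ((-⌊x i⌋ : ℤ) : ℝ))) i = Int.fract (x i) := by
          simp [Int.fract, sub_eq_add_neg]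
        rw [this, Real.norm_eq_abs, sq_abs]
        nlinarith
    _ = n := by simp

theorem IsZPeriodic.exists_norm_le {f : RSpace n → F} (hf : IsZPeriodic f) (hc : Continuous f) :
    ∃ C, 0 ≤ C ∧ ∀ x, ‖f x‖ ≤ C := by
  obtain ⟨C, hC⟩ := (isCompact_closedBall (0 : RSpace n) (√n)).exists_bound_of_continuousOn
    hc.continuousOn
  have h : ∀ x, ‖f x‖ ≤ C := by
    intro x
    obtain ⟨k, hk⟩ := exists_int_translate_norm_le x
    rw [← hf x k]
    exact hC _ (by simpa using hk)
  exact ⟨C, (norm_nonneg _).trans (h 0), h⟩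

variable [NormedSpace ℝ F]

theorem IsZPeriodic.fderiv {f : RSpace n → F} (hf : IsZPeriodic f) :
    IsZPeriodic (fderiv ℝ f) := by
  intro x k
  rw [← fderiv_comp_add_right]
  congr 1
  funext y
  exact hf y k

theorem IsZPeriodic.exists_fderiv_le {f : RSpace n → F} (hf : IsZPeriodic f)
    (hs : ContDiff ℝ 1 f) : ∃ L, 0 ≤ L ∧ ∀ x, ‖_root_.fderiv ℝ f x‖ ≤ L :=
  hf.fderiv.exists_norm_le (hs.continuous_fderiv one_ne_zero)

theorem IsZPeriodic.exists_lipschitz {f : RSpace n → F} (hf : IsZPeriodic f)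
    (hs : ContDiff ℝ 1 f) : ∃ L, 0 ≤ L ∧ ∀ x y, ‖f x - f y‖ ≤ L * ‖x - y‖ := by
  obtain ⟨L, hL0, hL⟩ := hf.exists_fderiv_le hs
  refine ⟨L, hL0, fun x y => ?_⟩
  exact convex_univ.norm_image_sub_le_of_norm_fderiv_le
    (fun z _ => hs.differentiable one_ne_zero z) (fun z _ => hL z) (mem_univ y) (mem_univ x)

/-- The three-point second difference of a smooth periodic function: `z` need not be the midpoint
of `x` and `y`, at the cost of a term linear in the defect `x + y - 2z`. -/
theorem IsZPeriodic.exists_second_difference_le {f : RSpace n → F} (hf : IsZPeriodic f)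
    (hs : ContDiff ℝ 2 f) :
    ∃ L, 0 ≤ L ∧ ∀ x y z, ‖f x + f y - (2 : ℝ) • f z‖ ≤
      L * (‖x + y - (2 : ℝ) • z‖ + ‖x - y‖ ^ 2) := by
  have hs1 : ContDiff ℝ 1 f := hs.of_le (by norm_num)
  have hd : Differentiable ℝ f := hs1.differentiable one_ne_zero
  obtain ⟨L₁, hL₁0, hL₁⟩ := hf.exists_lipschitz hs1
  obtain ⟨L₂, hL₂0, hL₂⟩ := hf.fderiv.exists_lipschitz
    (hs.fderiv_right (m := 1) (by norm_num))
  have hsym := fun m e : RSpace n => norm_symmetric_second_difference_le hd hL₂0 hL₂ m e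
  refine ⟨L₁ + 2 * L₂, by positivity, fun x y z => ?_⟩
  set m : RSpace n := (1 / 2 : ℝ) • (x + y)
  set e : RSpace n := (1 / 2 : ℝ) • (x - y) with he
  have hx : m + e = x := by simp only [m, e]; module
  have hy : m - e = y := by simp only [m, e]; module
  have h1 := hsym m e
  rw [hx, hy] at h1
  have h2 := hL₁ m z
  have hmz : m - z = (1 / 2 : ℝ) • (x + y - (2 : ℝ) • z) := by simp only [m]; module
  have hn1 : ‖m - z‖ = 1 / 2 * ‖x + y - (2 : ℝ) • z‖ := by
    rw [hmz, norm_smul]; norm_num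
  have hn2 : ‖e‖ = 1 / 2 * ‖x - y‖ := by
    rw [he, norm_smul]; norm_num
  rw [hn1] at h2
  rw [hn2] at h1
  have hsplit : f x + f y - (2 : ℝ) • f z =
      (f x + f y - (2 : ℝ) • f m) + (2 : ℝ) • (f m - f z) := by module
  rw [hsplit]
  refine (norm_add_le _ _).trans ?_
  rw [norm_smul, Real.norm_eq_abs, abs_two]
  nlinarith [norm_nonneg (x - y), norm_nonneg (x + y - (2 : ℝ) • z),
    mul_nonneg hL₂0 (norm_nonneg (x + y - (2 : ℝ) • z)),
    mul_nonneg hL₁0 (sq_nonneg ‖x - y‖), mul_nonneg hL₂0 (sq_nonneg ‖x - y‖)]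

end Periodic

/-! ### Dini differentials and test functions -/

section TestFunctions

variable {n : ℕ} {v φ : RSpace n → ℝ} {x p : RSpace n}

theorem mem_superdiff_of_le (hφ : HasFDerivAt φ (innerSL ℝ p) 0)
    (h : ∀ᶠ e in 𝓝 0, v (x + e) ≤ v x + (φ e - φ 0)) : p ∈ superdiff v x := by
  intro ε hε
  have h1 := (hasFDerivAt_iff_isLittleO_nhds_zero.1 hφ).def hε
  have ht : Tendsto (fun y => y - x) (𝓝 x) (𝓝 0) := by
    have : Continuous fun y : RSpace n => y - x := by fun_prop
    simpa using this.tendsto x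
  filter_upwards [ht.eventually h1, ht.eventually h] with y hy1 hy2
  simp only [zero_add, innerSL_apply_apply, Real.norm_eq_abs, add_sub_cancel] at hy1 hy2
  have := (abs_le.1 hy1).2
  linarith

theorem mem_subdiff_of_le (hφ : HasFDerivAt φ (innerSL ℝ p) 0)
    (h : ∀ᶠ e in 𝓝 0, v x + (φ e - φ 0) ≤ v (x + e)) : p ∈ subdiff v x := by
  intro ε hε
  have h1 := (hasFDerivAt_iff_isLittleO_nhds_zero.1 hφ).def hε
  have ht : Tendsto (fun y => y - x) (𝓝 x) (𝓝 0) := by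
    have : Continuous fun y : RSpace n => y - x := by fun_prop
    simpa using this.tendsto x
  filter_upwards [ht.eventually h1, ht.eventually h] with y hy1 hy2
  simp only [zero_add, innerSL_apply_apply, Real.norm_eq_abs, add_sub_cancel] at hy1 hy2
  have := (abs_le.1 hy1).1
  linarith

theorem mem_superdiff_liftedSolution {c : RSpace n} {u : RSpace n → ℝ} :
    p ∈ superdiff (liftedSolution c u) x ↔ p - c ∈ superdiff u x := by
  refine forall₂_congr fun ε _ => eventually_congr (Eventually.of_forall fun y => ?_)
  simp only [liftedSolution, inner_sub_left, inner_sub_right]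
  constructor <;> intro h <;> linarith

theorem mem_subdiff_liftedSolution {c : RSpace n} {u : RSpace n → ℝ} :
    p ∈ subdiff (liftedSolution c u) x ↔ p - c ∈ subdiff u x := by
  refine forall₂_congr fun ε _ => eventually_congr (Eventually.of_forall fun y => ?_)
  simp only [liftedSolution, inner_sub_left, inner_sub_right]
  constructor <;> intro h <;> linarith

theorem hasFDerivAt_norm_add_smul_sq (a : RSpace n) (α : ℝ) :
    HasFDerivAt (fun e : RSpace n => ‖a + α • e‖ ^ 2) (innerSL ℝ ((2 * α) • a)) 0 := by
  have h : HasFDerivAt (fun e : RSpace n => a + α • e)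
      (α • ContinuousLinearMap.id ℝ (RSpace n)) 0 :=
    ((hasFDerivAt_id (0 : RSpace n)).const_smul α).const_add a
  refine h.norm_sq.congr_fderiv ?_
  ext w
  simp
  ring

theorem HasFDerivAt.innerSL_sqrt {g : RSpace n → ℝ} (hg : HasFDerivAt g (innerSL ℝ p) 0)
    (h0 : g 0 ≠ 0) :
    HasFDerivAt (fun e => √(g e)) (innerSL ℝ ((1 / (2 * √(g 0))) • p)) 0 := by
  refine (hg.sqrt h0).congr_fderiv ?_
  ext w
  simp

end TestFunctions

/-! ### Lipschitz continuity and semiconcavity -/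

theorem exists_forall_le_of_outside_ball {n : ℕ} {g : RSpace n → ℝ} (hg : Continuous g)
    (x : RSpace n) {R : ℝ} (hR : 0 ≤ R) (h : ∀ y, R < ‖y - x‖ → g y ≤ g x) :
    ∃ y, ‖y - x‖ ≤ R ∧ ∀ z, g z ≤ g y := by
  obtain ⟨y, hy, hmax⟩ := (isCompact_closedBall x R).exists_isMaxOn
    ⟨x, Metric.mem_closedBall_self hR⟩ hg.continuousOn
  refine ⟨y, by simpa [dist_eq_norm] using hy, fun z => ?_⟩
  by_cases hz : ‖z - x‖ ≤ R
  · exact hmax (by simpa [dist_eq_norm] using hz)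
  · exact (h z (not_le.1 hz)).trans (hmax (Metric.mem_closedBall_self hR))

theorem continuous_liftedSolution {n : ℕ} {u : RSpace n → ℝ} (hc : Continuous u)
    (c : RSpace n) : Continuous (liftedSolution c u) := by
  unfold liftedSolution; fun_prop

/-- A viscosity subsolution of a coercive equation is Lipschitz: a cone `P ‖· - x‖` steeper than
every superdifferential can only touch `v` from above at its vertex. -/
theorem liftedSolution_lipschitz {n : ℕ} {u : RSpace n → ℝ} (hper : IsZPeriodic u)
    (hcont : Continuous u) {c : RSpace n} {P : ℝ} (hcP : ‖c‖ < P)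
    (hP : ∀ x, ∀ p ∈ superdiff (liftedSolution c u) x, ‖p‖ < P) (x y : RSpace n) :
    liftedSolution c u y - liftedSolution c u x ≤ P * ‖y - x‖ := by
  set v := liftedSolution c u with hv
  have hvc : Continuous v := continuous_liftedSolution hcont c
  have hP0 : 0 < P := (norm_nonneg c).trans_lt hcP
  obtain ⟨U, hU0, hU⟩ := hper.exists_norm_le hcont
  have hout : ∀ y, 2 * U / (P - ‖c‖) < ‖y - x‖ →
      v y - P * ‖y - x‖ ≤ v x - P * ‖x - x‖ := by
    intro y hy
    rw [div_lt_iff₀ (by linarith)] at hy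
    have h1 := abs_le.1 (hU x)
    have h2 := abs_le.1 (hU y)
    have h3 := real_inner_le_norm c (y - x)
    rw [inner_sub_right] at h3
    simp only [hv, liftedSolution, sub_self, norm_zero, mul_zero, sub_zero]
    nlinarith
  obtain ⟨w, -, hw⟩ := exists_forall_le_of_outside_ball (g := fun y => v y - P * ‖y - x‖)
    (by fun_prop) x (div_nonneg (by linarith) (by linarith)) hout
  by_cases hwx : w = x
  · have := hw y
    simp only [hwx, sub_self, norm_zero, mul_zero, sub_zero] at this
    linarith
  · exfalso
    have hne : ‖w - x‖ ≠ 0 := by simpa [sub_eq_zero] using hwx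
    have h1 := hasFDerivAt_norm_add_smul_sq (w - x) 1
    have h2 := h1.innerSL_sqrt (by simpa using hwx |> sub_ne_zero.2)
    have h3 : HasFDerivAt (fun e : RSpace n => P * √(‖w - x + (1 : ℝ) • e‖ ^ 2))
        (innerSL ℝ ((P / ‖w - x‖) • (w - x))) 0 := by
      refine (h2.const_mul P).congr_fderiv ?_
      ext e
      simp only [inner_smul_left, innerSL_apply_apply, _root_.smul_apply, smul_zero,
        add_zero, Real.sqrt_sq (norm_nonneg _), smul_eq_mul]
      simp
      field_simp
    have hmem : (P / ‖w - x‖) • (w - x) ∈ superdiff v w := by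
      refine mem_superdiff_of_le h3 (Eventually.of_forall fun e => ?_)
      have := hw (w + e)
      have he : w + e - x = w - x + e := by abel
      simp only [he] at this
      simp only [one_smul, Real.sqrt_sq (norm_nonneg _), add_zero]
      linarith
    have := hP w _ hmem
    rw [norm_smul, norm_div, norm_norm, div_mul_cancel₀ _ hne, Real.norm_eq_abs,
      abs_of_pos hP0] at this
    exact lt_irrefl _ this

/-- A field `B` of symmetric operators on `ℝⁿ` which is uniformly elliptic with constant `l`, and
which is bounded, Lipschitz and of bounded second differences with constant `K`. It stands for the
fibre metric `p ↦ ⟨B x p, p⟩` on covectors. -/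
structure IsUniformCometric {n : ℕ} (B : RSpace n → RSpace n →L[ℝ] RSpace n) (l K : ℝ) :
    Prop where
  symm : ∀ x p q, inner ℝ (B x p) q = inner ℝ p (B x q)
  pos : 0 < l
  nonneg : 0 ≤ K
  elliptic : ∀ x p, l * ‖p‖ ^ 2 ≤ inner ℝ (B x p) p
  norm_le : ∀ x, ‖B x‖ ≤ K
  lipschitz : ∀ x y, ‖B x - B y‖ ≤ K * ‖x - y‖
  second : ∀ x y z, ‖B x + B y - (2 : ℝ) • B z‖ ≤
    K * (‖x + y - (2 : ℝ) • z‖ + ‖x - y‖ ^ 2)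

theorem abs_inner_apply_le {n : ℕ} (T : RSpace n →L[ℝ] RSpace n) (p q : RSpace n) :
    |inner ℝ (T p) q| ≤ ‖T‖ * ‖p‖ * ‖q‖ :=
  (abs_real_inner_le_norm _ _).trans
    (mul_le_mul_of_nonneg_right (T.le_opNorm p) (norm_nonneg q))

/-- The quantitative form of the uniform convexity of `p ↦ ½⟨B x p, p⟩ + V x`: if `r + d` and
`r - d` are subsolution slopes at `x` and `y`, and `r` is a supersolution slope at `z`, then
`d` is controlled by the distances between the three points. -/
theorem IsUniformCometric.norm_sq_half_difference_le {n : ℕ}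
    {B : RSpace n → RSpace n →L[ℝ] RSpace n} {l K : ℝ} (hB : IsUniformCometric B l K)
    {V : RSpace n → ℝ}
    (hV : ∀ x y z, ‖V x + V y - (2 : ℝ) • V z‖ ≤ K * (‖x + y - (2 : ℝ) • z‖ + ‖x - y‖ ^ 2))
    {E : ℝ} {x y z r d : RSpace n}
    (hx : 1 / 2 * inner ℝ (B x (r + d)) (r + d) + V x ≤ E)
    (hy : 1 / 2 * inner ℝ (B y (r - d)) (r - d) + V y ≤ E)
    (hz : E ≤ 1 / 2 * inner ℝ (B z r) r + V z) :
    2 * l * ‖d‖ ^ 2 ≤ K * (‖x + y - (2 : ℝ) • z‖ + ‖x - y‖ ^ 2) * (‖r‖ ^ 2 + 2)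
      + 2 * K * ‖x - y‖ * ‖r‖ * ‖d‖ := by
  have h1 := (abs_inner_apply_le (B x + B y - (2 : ℝ) • B z) r r).trans
    (mul_le_mul_of_nonneg_right (mul_le_mul_of_nonneg_right (hB.second x y z) (norm_nonneg r))
      (norm_nonneg r))
  have h2 := (abs_inner_apply_le (B x - B y) r d).trans
    (mul_le_mul_of_nonneg_right (mul_le_mul_of_nonneg_right (hB.lipschitz x y) (norm_nonneg r))
      (norm_nonneg d))
  have h3 := hV x y z
  have h4 := hB.elliptic x d
  have h5 := hB.elliptic y d
  have sx : inner ℝ (B x d) r = inner ℝ (B x r) d := by rw [hB.symm, real_inner_comm]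
  have sy : inner ℝ (B y d) r = inner ℝ (B y r) d := by rw [hB.symm, real_inner_comm]
  simp only [_root_.sub_apply, _root_.add_apply, inner_sub_left,
    inner_add_left, _root_.smul_apply, inner_smul_left] at h1 h2
  simp only [map_add, map_sub, inner_add_left, inner_add_right, inner_sub_left,
    inner_sub_right] at hx hy
  simp only [Real.norm_eq_abs, smul_eq_mul] at h3
  simp at h1
  have h1' := (abs_le.1 h1).1
  have h2' := (abs_le.1 h2).1
  have h3' := (abs_le.1 h3).1
  nlinarith

/-- The gradient of the penalty `√(‖a‖⁴ + ‖b‖²)` along an affine motion of `a` and `b`. -/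
theorem hasFDerivAt_penalty {n : ℕ} (M : ℝ) (a b : RSpace n) (α β : ℝ)
    (h0 : (‖a‖ ^ 2) ^ 2 + ‖b‖ ^ 2 ≠ 0) :
    HasFDerivAt (fun e : RSpace n => M * √((‖a + α • e‖ ^ 2) ^ 2 + ‖b + β • e‖ ^ 2))
      (innerSL ℝ ((M / √((‖a‖ ^ 2) ^ 2 + ‖b‖ ^ 2)) •
        ((2 * α * ‖a‖ ^ 2) • a + β • b))) 0 := by
  have h1 := hasFDerivAt_norm_add_smul_sq a α
  have h2 := hasFDerivAt_norm_add_smul_sq b β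
  have h3 : HasFDerivAt (fun e : RSpace n => (‖a + α • e‖ ^ 2) ^ 2 + ‖b + β • e‖ ^ 2)
      (innerSL ℝ ((4 * α * ‖a‖ ^ 2) • a + (2 * β) • b)) 0 := by
    refine ((h1.pow 2).add h2).congr_fderiv ?_
    ext w
    simp
    ring
  have h4 := (h3.innerSL_sqrt (by simpa using h0)).const_mul M
  refine h4.congr_fderiv ?_
  have hpos : √((‖a‖ ^ 2) ^ 2 + ‖b‖ ^ 2) ≠ 0 := by
    rw [Real.sqrt_ne_zero (by positivity)]; exact h0
  ext w
  simp
  field_simp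
  ring

theorem le_sqrt_sq_add_sq {s t : ℝ} (hs : 0 ≤ s) (ht : 0 ≤ t) :
    s ≤ √(s ^ 2 + t ^ 2) ∧ t ≤ √(s ^ 2 + t ^ 2) ∧ √(s ^ 2 + t ^ 2) ≤ s + t := by
  refine ⟨Real.le_sqrt_of_sq_le (by nlinarith), Real.le_sqrt_of_sq_le (by nlinarith), ?_⟩
  rw [Real.sqrt_le_left (by positivity)]
  nlinarith

theorem liftedSolution_add_int {n : ℕ} {u : RSpace n → ℝ} (hper : IsZPeriodic u) (c x : RSpace n)
    (k : Fin n → ℤ) : liftedSolution c u (x + WithLp.toLp 2 (fun i => (k i : ℝ))) =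
      liftedSolution c u x + inner ℝ c (WithLp.toLp 2 (fun i => (k i : ℝ))) := by
  simp only [liftedSolution, hper x k, inner_add_right]
  ring

/-- The three-point function whose maxima are analysed in the proof of semiconcavity. -/
noncomputable def threePoint {n : ℕ} (v : RSpace n → ℝ) (M : ℝ) (x y z : RSpace n) : ℝ :=
  v x + v y - 2 * v z - M * √((‖x - y‖ ^ 2) ^ 2 + ‖x + y - (2 : ℝ) • z‖ ^ 2)

/-- If `threePoint v M` is positive somewhere, it has a positive global maximum: `u` is bounded, and
the penalty absorbs the linear part of `v`. -/
theorem exists_forall_threePoint_le {n : ℕ} {u : RSpace n → ℝ} (hper : IsZPeriodic u)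
    (hcont : Continuous u) {c : RSpace n} {M : ℝ} (hM : ‖c‖ + 1 ≤ M) {x₀ y₀ z₀ : RSpace n}
    (hpos : 0 < threePoint (liftedSolution c u) M x₀ y₀ z₀) :
    ∃ x y z, 0 < threePoint (liftedSolution c u) M x y z ∧
      ∀ x' y' z', threePoint (liftedSolution c u) M x' y' z' ≤
        threePoint (liftedSolution c u) M x y z := by
  set v := liftedSolution c u with hv
  have hvc : Continuous v := continuous_liftedSolution hcont c
  obtain ⟨U, hU0, hU⟩ := hper.exists_norm_le hcont
  set D : Set (RSpace n × RSpace n × RSpace n) := Metric.closedBall 0 (4 * U + 1) ×ˢ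
    Metric.closedBall 0 (4 * U + 1) ×ˢ Metric.closedBall 0 (√n) with hD
  have hDc : IsCompact D := (isCompact_closedBall _ _).prod
    ((isCompact_closedBall _ _).prod (isCompact_closedBall _ _))
  set Ψ : RSpace n × RSpace n × RSpace n → ℝ :=
    fun t => threePoint v M (t.2.2 + t.1) (t.2.2 + t.2.1) t.2.2 with hΨ
  have hΨc : Continuous Ψ := by
    simp only [hΨ, threePoint]
    fun_prop
  -- A positive value is attained with `x - z` and `y - z` bounded, and then, by periodicity, also
  -- with `z` bounded.
  have hred : ∀ x y z, 0 < threePoint v M x y z →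
      ∃ t ∈ D, Ψ t = threePoint v M x y z := by
    intro x y z h
    obtain ⟨k, hk⟩ := exists_int_translate_norm_le z
    set κ : RSpace n := WithLp.toLp 2 (fun i => (k i : ℝ)) with hκ
    refine ⟨(x - z, y - z, z + κ), ?_, ?_⟩
    · obtain ⟨ha, hb, -⟩ := le_sqrt_sq_add_sq (s := ‖x - y‖ ^ 2) (t := ‖x + y - (2 : ℝ) • z‖)
        (by positivity) (norm_nonneg _)
      set ψ := √((‖x - y‖ ^ 2) ^ 2 + ‖x + y - (2 : ℝ) • z‖ ^ 2) with hψ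
      have hval : v x + v y - 2 * v z = u x + u y - 2 * u z +
          inner ℝ c (x + y - (2 : ℝ) • z) := by
        simp only [hv, liftedSolution, inner_sub_right, inner_add_right, inner_smul_right]
        ring
      have hc := real_inner_le_norm c (x + y - (2 : ℝ) • z)
      have h1 := (abs_le.1 (hU x)).2
      have h2 := (abs_le.1 (hU y)).2
      have h3 := (abs_le.1 (hU z)).1
      simp only [threePoint, ← hψ, hval] at h
      have hψU : ψ ≤ 4 * U := by
        have h5 : ‖c‖ * ‖x + y - (2 : ℝ) • z‖ ≤ ‖c‖ * ψ :=
          mul_le_mul_of_nonneg_left hb (norm_nonneg c)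
        have h6 : (‖c‖ + 1) * ψ ≤ M * ψ :=
          mul_le_mul_of_nonneg_right hM (Real.sqrt_nonneg _)
        linarith
      have hab : ‖x - y‖ ≤ 1 + 4 * U := by nlinarith [sq_nonneg (‖x - y‖ - 1), norm_nonneg (x - y)]
      have e1 : x - z = (1 / 2 : ℝ) • ((x - y) + (x + y - (2 : ℝ) • z)) := by module
      have e2 : y - z = (1 / 2 : ℝ) • (-(x - y) + (x + y - (2 : ℝ) • z)) := by module
      have n1 : ‖x - z‖ ≤ 4 * U + 1 := by
        rw [e1, norm_smul]
        have := norm_add_le (x - y) (x + y - (2 : ℝ) • z)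
        norm_num
        linarith
      have n2 : ‖y - z‖ ≤ 4 * U + 1 := by
        rw [e2, norm_smul]
        have := norm_add_le (-(x - y)) (x + y - (2 : ℝ) • z)
        rw [norm_neg] at this
        norm_num at this ⊢
        linarith
      simpa [hD] using ⟨n1, n2, hk⟩
    · have t1 : z + κ + (x - z) = x + κ := by abel
      have t2 : z + κ + (y - z) = y + κ := by abel
      have t3 : x + κ - (y + κ) = x - y := by abel
      have t4 : x + κ + (y + κ) - (2 : ℝ) • (z + κ) = x + y - (2 : ℝ) • z := by module
      have hv' : ∀ w, v (w + κ) = v w + inner ℝ c κ := fun w => liftedSolution_add_int hper c w k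
      change threePoint v M (z + κ + (x - z)) (z + κ + (y - z)) (z + κ) = _
      rw [t1, t2]
      simp only [threePoint, t3, t4, hv']
      ring
  obtain ⟨t₀, ht₀, ht₀'⟩ := hred _ _ _ hpos
  obtain ⟨t, -, hmax⟩ := hDc.exists_isMaxOn ⟨t₀, ht₀⟩ hΨc.continuousOn
  have hpos' : 0 < Ψ t := by
    have : Ψ t₀ ≤ Ψ t := hmax ht₀
    linarith
  refine ⟨_, _, _, hpos', fun x' y' z' => ?_⟩
  by_cases h : 0 < threePoint v M x' y' z'
  · obtain ⟨t', ht', he⟩ := hred _ _ _ h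
    rw [← he]
    exact hmax ht'
  · exact (not_lt.1 h).trans hpos'.le

/-- Viscosity solutions of a uniformly convex equation are semiconcave: for `M` large,
`v x + v y - 2 v z ≤ M √(‖x - y‖⁴ + ‖x + y - 2z‖²)`. At a positive maximum of the difference, the
test gradients at `x`, `y`, `z` are `r + d`, `r - d`, `r` with `‖d‖ ≥ M ‖x - y‖`, which uniform
convexity forbids. -/
theorem exists_semiconcave_const {n : ℕ} {u : RSpace n → ℝ} (hper : IsZPeriodic u)
    (hcont : Continuous u) {c : RSpace n} {B : RSpace n → RSpace n →L[ℝ] RSpace n} {l K : ℝ}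
    (hB : IsUniformCometric B l K) {V : RSpace n → ℝ}
    (hV : ∀ x y z, ‖V x + V y - (2 : ℝ) • V z‖ ≤ K * (‖x + y - (2 : ℝ) • z‖ + ‖x - y‖ ^ 2))
    {E P : ℝ} (hP0 : 0 ≤ P)
    (hP : ∀ x, ∀ p ∈ superdiff (liftedSolution c u) x, ‖p‖ ≤ P)
    (hsub : ∀ x, ∀ p ∈ superdiff (liftedSolution c u) x, 1 / 2 * inner ℝ (B x p) p + V x ≤ E)
    (hsup : ∀ x, ∀ p ∈ subdiff (liftedSolution c u) x, E ≤ 1 / 2 * inner ℝ (B x p) p + V x) :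
    ∃ C, 0 ≤ C ∧ ∀ x e, liftedSolution c u (x + e) + liftedSolution c u (x - e)
      - 2 * liftedSolution c u x ≤ C * ‖e‖ ^ 2 := by
  set v := liftedSolution c u with hv
  have hl := hB.pos
  have hK := hB.nonneg
  set Q : ℝ := K * P ^ 2 + 2 * K + K * P with hQ
  have hQ0 : 0 ≤ Q := by positivity
  set M : ℝ := max (max (‖c‖ + 1) (2 * P)) (Q / l + 1) with hM
  have hM1 : ‖c‖ + 1 ≤ M := (le_max_left _ _).trans (le_max_left _ _)
  have hM2 : 2 * P ≤ M := (le_max_right _ _).trans (le_max_left _ _)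
  have hM3 : Q / l + 1 ≤ M := le_max_right _ _
  have hM0 : 1 ≤ M := by linarith [norm_nonneg c]
  have hMQ : Q < M * l := by
    have : Q / l < M := by linarith
    rwa [div_lt_iff₀ hl] at this
  clear_value M
  have key : ∀ x y z, threePoint v M x y z ≤ 0 := by
    by_contra hcon
    push Not at hcon
    obtain ⟨x₀, y₀, z₀, h₀⟩ := hcon
    obtain ⟨x, y, z, hpos, hmax⟩ := exists_forall_threePoint_le hper hcont hM1 h₀
    rw [← hv] at hpos hmax
    simp only [threePoint] at hpos hmax
    set a := x - y with ha
    set b := x + y - (2 : ℝ) • z with hb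
    have h0 : (‖a‖ ^ 2) ^ 2 + ‖b‖ ^ 2 ≠ 0 := by
      intro h0
      have ha0 : a = 0 := by
        have : (‖a‖ ^ 2) ^ 2 = 0 := by nlinarith [sq_nonneg (‖a‖ ^ 2), sq_nonneg ‖b‖]
        simpa using this
      have hb0 : b = 0 := by
        have : ‖b‖ ^ 2 = 0 := by nlinarith [sq_nonneg (‖a‖ ^ 2), sq_nonneg ‖b‖]
        simpa using this
      have hxy : x = y := sub_eq_zero.1 ha0
      have hxz : x = z := by
        have : (2 : ℝ) • (x - z) = 0 := by rw [← hb0, hb, ← hxy]; module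
        simpa [sub_eq_zero] using this
      rw [h0, ← hxy, ← hxz] at hpos
      simp at hpos
      linarith
    obtain ⟨hψa, hψb, hψab⟩ := le_sqrt_sq_add_sq (s := ‖a‖ ^ 2) (t := ‖b‖)
      (by positivity) (norm_nonneg _)
    have hψ0 : 0 < √((‖a‖ ^ 2) ^ 2 + ‖b‖ ^ 2) :=
      Real.sqrt_pos.2 (lt_of_le_of_ne (by positivity) (Ne.symm h0))
    have hg := fun α β => hasFDerivAt_penalty M a b α β h0
    set ψ := √((‖a‖ ^ 2) ^ 2 + ‖b‖ ^ 2) with hψ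
    set r : RSpace n := (M / ψ) • b with hr
    set d : RSpace n := (2 * M * ‖a‖ ^ 2 / ψ) • a with hd
    have hx : r + d ∈ superdiff v x := by
      have h1 := hg 1 1
      have h2 : (M / ψ) • ((2 * 1 * ‖a‖ ^ 2) • a + (1 : ℝ) • b) = r + d := by
        simp only [hr, hd]; module
      rw [h2] at h1
      refine mem_superdiff_of_le h1 (Eventually.of_forall fun e => ?_)
      have := hmax (x + e) y z
      have e1 : x + e - y = a + (1 : ℝ) • e := by simp only [ha]; module
      have e2 : x + e + y - (2 : ℝ) • z = b + (1 : ℝ) • e := by simp only [hb]; module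
      rw [e1, e2] at this
      simp only [smul_zero, add_zero, ← hψ]
      linarith
    have hy : r - d ∈ superdiff v y := by
      have h1 := hg (-1) 1
      have h2 : (M / ψ) • ((2 * (-1) * ‖a‖ ^ 2) • a + (1 : ℝ) • b) = r - d := by
        simp only [hr, hd]; module
      rw [h2] at h1
      refine mem_superdiff_of_le h1 (Eventually.of_forall fun e => ?_)
      have := hmax x (y + e) z
      have e1 : x - (y + e) = a + (-1 : ℝ) • e := by simp only [ha]; module
      have e2 : x + (y + e) - (2 : ℝ) • z = b + (1 : ℝ) • e := by simp only [hb]; module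
      rw [e1, e2] at this
      simp only [smul_zero, add_zero, ← hψ]
      linarith
    have hz : r ∈ subdiff v z := by
      have h1 := (hg 0 (-2)).const_mul (-1 / 2)
      have h2 : (-1 / 2 : ℝ) • innerSL ℝ ((M / ψ) • ((2 * 0 * ‖a‖ ^ 2) • a + (-2 : ℝ) • b)) =
          innerSL ℝ r := by
        rw [← map_smul]
        congr 1
        simp only [hr]; module
      rw [h2] at h1
      refine mem_subdiff_of_le h1 (Eventually.of_forall fun e => ?_)
      have := hmax x y (z + e)
      have e1 : x - y = a + (0 : ℝ) • e := by simp only [ha]; module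
      have e2 : x + y - (2 : ℝ) • (z + e) = b + (-2 : ℝ) • e := by simp only [hb]; module
      rw [e1, e2] at this
      simp only [smul_zero, add_zero, ← hψ]
      linarith
    have hrP : ‖r‖ ≤ P := by
      have h1 := hP x _ hx
      have h2 := hP y _ hy
      have h3 : r = (1 / 2 : ℝ) • ((r + d) + (r - d)) := by module
      rw [h3, norm_smul]
      have := norm_add_le (r + d) (r - d)
      norm_num at this ⊢
      linarith
    have hbnorm : M * ‖b‖ ≤ P * ψ := by
      rw [hr, norm_smul, Real.norm_eq_abs, abs_of_pos (by positivity), div_mul_eq_mul_div,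
        div_le_iff₀ hψ0] at hrP
      exact hrP
    have hba : ‖b‖ ≤ ‖a‖ ^ 2 := by
      have h1 : P * ψ ≤ P * (‖a‖ ^ 2 + ‖b‖) := mul_le_mul_of_nonneg_left hψab hP0
      have h2 : 2 * P * ‖b‖ ≤ M * ‖b‖ := mul_le_mul_of_nonneg_right hM2 (norm_nonneg b)
      have h3 : 2 * P * ‖a‖ ^ 2 ≤ M * ‖a‖ ^ 2 := mul_le_mul_of_nonneg_right hM2 (by positivity)
      have h4 : M * ‖b‖ ≤ M * ‖a‖ ^ 2 := by linarith
      exact le_of_mul_le_mul_left h4 (by linarith)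
    have ha0 : 0 < ‖a‖ := by
      rcases (norm_nonneg a).lt_or_eq with h | h
      · exact h
      · exfalso
        rw [← h] at hba
        have : ‖b‖ = 0 := le_antisymm (by simpa using hba) (norm_nonneg b)
        exact h0 (by rw [← h, this]; norm_num)
    have hda : M * ‖a‖ ≤ ‖d‖ := by
      rw [hd, norm_smul, Real.norm_eq_abs, abs_of_pos (by positivity), div_mul_eq_mul_div,
        le_div_iff₀ hψ0]
      have : M * ‖a‖ * ψ ≤ M * ‖a‖ * (2 * ‖a‖ ^ 2) :=
        mul_le_mul_of_nonneg_left (by linarith) (by positivity)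
      linarith
    have hconv := hB.norm_sq_half_difference_le hV (hsub x _ hx) (hsub y _ hy) (hsup z _ hz)
    rw [← ha, ← hb] at hconv
    -- With `‖b‖ ≤ ‖a‖²`, `‖r‖ ≤ P` and `‖a‖ ≤ ‖d‖ / M` this reads `l ‖d‖² ≤ Q ‖d‖² / M`.
    have had : ‖a‖ ^ 2 ≤ ‖a‖ * ‖d‖ := by nlinarith
    have h1 : K * (‖b‖ + ‖a‖ ^ 2) * (‖r‖ ^ 2 + 2) ≤ K * (2 * (‖a‖ * ‖d‖)) * (P ^ 2 + 2) := by
      gcongr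
      linarith
    have h2 : 2 * K * ‖a‖ * ‖r‖ * ‖d‖ ≤ 2 * K * ‖a‖ * P * ‖d‖ := by gcongr
    have h3 : l * ‖d‖ ^ 2 ≤ Q * (‖a‖ * ‖d‖) := by
      simp only [hQ]
      linarith [h1, h2, hconv]
    have hd0 : 0 < ‖d‖ := by nlinarith
    have h4 : l * ‖d‖ ≤ Q * ‖a‖ := by
      have : (l * ‖d‖) * ‖d‖ ≤ (Q * ‖a‖) * ‖d‖ := by linarith
      exact le_of_mul_le_mul_right this hd0
    have h5 : l * (M * ‖a‖) ≤ l * ‖d‖ := mul_le_mul_of_nonneg_left hda hl.le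
    have h6 : M * l * ‖a‖ ≤ Q * ‖a‖ := by linarith
    have h7 : M * l ≤ Q := le_of_mul_le_mul_right h6 ha0
    linarith
  refine ⟨4 * M, by linarith, fun x e => ?_⟩
  have := key (x + e) (x - e) x
  have e1 : x + e - (x - e) = (2 : ℝ) • e := by module
  have e2 : x + e + (x - e) - (2 : ℝ) • x = 0 := by module
  simp only [threePoint, e1, e2, norm_smul, norm_zero] at this
  rw [zero_pow two_ne_zero, add_zero, Real.sqrt_sq (by positivity)] at this
  norm_num [mul_pow] at this
  linarith

/-! ### Superdifferentials of semiconcave functions -/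

/-- `v` is Lipschitz with constant `P`, which also bounds its superdifferentials, and semiconcave
with linear modulus: `C‖·‖² - v` is midpoint convex. -/
structure IsLipschitzSemiconcave {n : ℕ} (v : RSpace n → ℝ) (P C : ℝ) : Prop where
  nonneg : 0 ≤ C
  lipschitz : ∀ x y, v y - v x ≤ P * ‖y - x‖
  norm_le : ∀ x, ∀ p ∈ superdiff v x, ‖p‖ ≤ P
  semiconcave : ∀ x e, v (x + e) + v (x - e) - 2 * v x ≤ 2 * C * ‖e‖ ^ 2

namespace IsLipschitzSemiconcave

variable {n : ℕ} {v : RSpace n → ℝ} {P C : ℝ} {x : RSpace n}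

theorem abs_sub_le (h : IsLipschitzSemiconcave v P C) (x y : RSpace n) :
    |v y - v x| ≤ P * ‖y - x‖ := by
  rw [abs_le]
  have := h.lipschitz y x
  rw [norm_sub_rev] at this
  exact ⟨by linarith, h.lipschitz x y⟩

theorem continuous (h : IsLipschitzSemiconcave v P C) : Continuous v := by
  refine (LipschitzWith.of_dist_le_mul (K := P.toNNReal) fun x y => ?_).continuous
  rw [dist_eq_norm, dist_eq_norm, Real.norm_eq_abs]
  exact (h.abs_sub_le y x).trans (mul_le_mul_of_nonneg_right (Real.le_coe_toNNReal P)
    (norm_nonneg _))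

/-- A supergradient of a semiconcave function at `x` gives a global upper paraboloid touching at
`x`. -/
theorem le_of_mem_superdiff (h : IsLipschitzSemiconcave v P C) {p : RSpace n}
    (hp : p ∈ superdiff v x) (y : RSpace n) :
    v y ≤ v x + inner ℝ p (y - x) + C * ‖y - x‖ ^ 2 := by
  set θ := y - x with hθ
  set φ : ℝ → ℝ := fun t => v (x + t • θ) - v x - t * inner ℝ p θ with hφ
  have hhalf : ∀ t, φ t ≤ 2 * φ (t / 2) + 2 * C * (t / 2) ^ 2 * ‖θ‖ ^ 2 := by
    intro t
    have := h.semiconcave (x + (t / 2) • θ) ((t / 2) • θ)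
    have e1 : x + (t / 2) • θ + (t / 2) • θ = x + t • θ := by module
    have e2 : x + (t / 2) • θ - (t / 2) • θ = x := by module
    rw [e1, e2, norm_smul, mul_pow, Real.norm_eq_abs, sq_abs] at this
    simp only [hφ]
    linarith
  have hiter : ∀ k : ℕ, φ 1 ≤ 2 ^ k * φ ((1 / 2) ^ k) + C * ‖θ‖ ^ 2 * (1 - (1 / 2) ^ k) := by
    intro k
    induction k with
    | zero => simp
    | succ k ih =>
      have h1 := hhalf ((1 / 2) ^ k)
      have h2 : ((1 : ℝ) / 2) ^ k / 2 = (1 / 2) ^ (k + 1) := by ring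
      rw [h2] at h1
      have h3 : (2 : ℝ) ^ k * (1 / 2) ^ k = 1 := by rw [← mul_pow]; norm_num
      have h4 := mul_le_mul_of_nonneg_left h1 (by positivity : (0 : ℝ) ≤ 2 ^ k)
      have h5 : (2 : ℝ) ^ k * (2 * C * ((1 / 2) ^ (k + 1)) ^ 2 * ‖θ‖ ^ 2) =
          C * ‖θ‖ ^ 2 * (1 / 2) ^ (k + 1) := by
        calc _ = C * ‖θ‖ ^ 2 * (1 / 2) ^ (k + 1) * (2 ^ k * (1 / 2) ^ k) := by ring
          _ = _ := by rw [h3, mul_one]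
      have h6 : C * ‖θ‖ ^ 2 * (1 / 2) ^ k = 2 * (C * ‖θ‖ ^ 2 * (1 / 2) ^ (k + 1)) := by ring
      rw [mul_add, h5] at h4
      have h7 : (2 : ℝ) ^ k * (2 * φ ((1 / 2) ^ (k + 1))) =
        2 ^ (k + 1) * φ ((1 / 2) ^ (k + 1)) := by ring
      linarith
  have hsmall : ∀ ε : ℝ, 0 < ε → φ 1 ≤ ε * ‖θ‖ + C * ‖θ‖ ^ 2 := by
    intro ε hε
    have ht : Tendsto (fun k : ℕ => x + ((1 / 2 : ℝ) ^ k) • θ) atTop (𝓝 x) := by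
      have := ((tendsto_pow_atTop_nhds_zero_of_lt_one (by norm_num : (0 : ℝ) ≤ 1 / 2)
        (by norm_num)).smul_const θ).const_add x
      simpa using this
    obtain ⟨k, hk⟩ := (ht.eventually (hp ε hε)).exists
    have h3 : (2 : ℝ) ^ k * (1 / 2) ^ k = 1 := by rw [← mul_pow]; norm_num
    rw [add_sub_cancel_left, norm_smul, inner_smul_right, Real.norm_eq_abs,
      abs_of_pos (by positivity)] at hk
    have h4 := mul_le_mul_of_nonneg_left hk (by positivity : (0 : ℝ) ≤ 2 ^ k)
    have h5 : (2 : ℝ) ^ k * (ε * ((1 / 2) ^ k * ‖θ‖)) = ε * ‖θ‖ := by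
      calc _ = ε * ‖θ‖ * (2 ^ k * (1 / 2) ^ k) := by ring
        _ = _ := by rw [h3, mul_one]
    rw [h5] at h4
    have h6 : 0 ≤ C * ‖θ‖ ^ 2 * (1 / 2) ^ k := by have := h.nonneg; positivity
    have := hiter k
    simp only [hφ] at this ⊢
    linarith
  have hfin : φ 1 ≤ C * ‖θ‖ ^ 2 := by
    refine le_of_forall_pos_le_add fun ε hε => ?_
    have h1 := hsmall (ε / (‖θ‖ + 1)) (by positivity)
    have h2 : ε / (‖θ‖ + 1) * ‖θ‖ ≤ ε := by
      rw [div_mul_eq_mul_div, div_le_iff₀ (by positivity)]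
      nlinarith
    linarith
  have e1 : x + (1 : ℝ) • θ = y := by rw [one_smul, hθ]; abel
  simp only [hφ, e1, one_mul] at hfin
  linarith

theorem mem_superdiff_iff (h : IsLipschitzSemiconcave v P C) {p : RSpace n} :
    p ∈ superdiff v x ↔ ∀ y, v y ≤ v x + inner ℝ p (y - x) + C * ‖y - x‖ ^ 2 := by
  refine ⟨fun hp y => h.le_of_mem_superdiff hp y, fun hp ε hε => ?_⟩
  have hC : 0 < C + 1 := by linarith [h.nonneg]
  have ht : ∀ᶠ y in 𝓝 x, ‖y - x‖ < ε / (C + 1) := by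
    filter_upwards [Metric.ball_mem_nhds x (div_pos hε hC)] with y hy
    rwa [← dist_eq_norm]
  filter_upwards [ht] with y hy
  have h1 := hp y
  rw [lt_div_iff₀ hC] at hy
  nlinarith [norm_nonneg (y - x)]

theorem convex_superdiff (h : IsLipschitzSemiconcave v P C) (x : RSpace n) :
    Convex ℝ (superdiff v x) := by
  intro p hp q hq s t hs ht hst
  rw [h.mem_superdiff_iff] at hp hq ⊢
  intro y
  rw [inner_add_left, inner_smul_left, inner_smul_left]
  simp only [conj_trivial]
  have h1 := mul_le_mul_of_nonneg_left (hp y) hs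
  have h2 := mul_le_mul_of_nonneg_left (hq y) ht
  obtain rfl : s = 1 - t := by linarith
  linarith

/-- The graph of the superdifferential of a semiconcave function is closed. -/
theorem isClosed_graph (h : IsLipschitzSemiconcave v P C) :
    IsClosed {z : RSpace n × RSpace n | z.2 ∈ superdiff v z.1} := by
  have hv := h.continuous
  simp only [h.mem_superdiff_iff, ofPred_forall]
  refine isClosed_iInter fun y => isClosed_le (by fun_prop) (by fun_prop)

theorem isCompact_superdiff (h : IsLipschitzSemiconcave v P C) (x : RSpace n) :
    IsCompact (superdiff v x) := by
  refine Metric.isCompact_of_isClosed_isBounded ?_ ?_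
  · exact h.isClosed_graph.preimage (Continuous.prodMk_right x)
  · exact Metric.isBounded_closedBall.subset
      (fun p hp => by simpa using h.norm_le x p hp : superdiff v x ⊆ Metric.closedBall 0 P)

/-- Maximum points of `v - k‖· - x‖²` carry supergradients and converge to `x` as `k → ∞`, so the
superdifferential at `x` is nonempty by the closedness of the graph. -/
theorem nonempty_superdiff (h : IsLipschitzSemiconcave v P C) (x : RSpace n) :
    (superdiff v x).Nonempty := by
  have hv := h.continuous
  have hex : ∀ k : ℕ, ∃ y p, ‖y - x‖ ≤ P ^ 2 / (k + 1) + 1 / (k + 1) ∧ p ∈ superdiff v y := by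
    intro k
    have hk : (0 : ℝ) < k + 1 := by positivity
    set m : ℝ := (k + 1) with hm
    obtain ⟨y, hy, hmax⟩ := exists_forall_le_of_outside_ball
      (g := fun y => v y - m * ‖y - x‖ ^ 2) (by fun_prop) x
      (R := P ^ 2 / m + 1 / m) (by positivity) (by
        intro y hy
        have h1 := h.lipschitz x y
        have h2 : P ≤ m * ‖y - x‖ := by
          rw [← add_div, div_lt_iff₀ hk] at hy
          nlinarith [sq_nonneg (P - 1)]
        have h3 := mul_le_mul_of_nonneg_right h2 (norm_nonneg (y - x))
        simp only [sub_self, norm_zero]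
        nlinarith)
    refine ⟨y, m • ((2 * 1 : ℝ) • (y - x)), hy, ?_⟩
    have hd := (hasFDerivAt_norm_add_smul_sq (y - x) 1).const_mul m
    rw [← map_smul] at hd
    refine mem_superdiff_of_le hd (Eventually.of_forall fun e => ?_)
    have := hmax (y + e)
    have e1 : y + e - x = y - x + (1 : ℝ) • e := by module
    simp only [e1] at this
    simp only [smul_zero, add_zero]
    linarith
  choose y p hy hp using hex
  have hyx : Tendsto y atTop (𝓝 x) := by
    rw [tendsto_iff_norm_sub_tendsto_zero]
    refine squeeze_zero (fun _ => norm_nonneg _) hy ?_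
    have h1 := tendsto_one_div_add_atTop_nhds_zero_nat (𝕜 := ℝ)
    have h2 := (h1.const_mul (P ^ 2)).add h1
    simpa [div_eq_mul_inv] using h2
  obtain ⟨q, -, φ, hφ, hq⟩ := (isCompact_closedBall (0 : RSpace n) P).tendsto_subseq
    (fun k => (by simpa using h.norm_le _ _ (hp k) : p k ∈ Metric.closedBall (0 : RSpace n) P))
  exact ⟨q, h.isClosed_graph.mem_of_tendsto ((hyx.comp hφ.tendsto_atTop).prodMk_nhds hq)
    (Eventually.of_forall fun k => hp (φ k))⟩

/-- Upper semicontinuity of the superdifferential of a semiconcave function. -/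
theorem eventually_superdiff (h : IsLipschitzSemiconcave v P C) (x : RSpace n)
    {O : Set (RSpace n)} (hO : IsOpen O) (hx : superdiff v x ⊆ O) :
    ∀ᶠ y in 𝓝 x, superdiff v y ⊆ O := by
  have hK : IsCompact (Metric.closedBall (0 : RSpace n) P \ O) :=
    (isCompact_closedBall _ _).diff hO
  have := hK.eventually_forall_of_forall_eventually (x₀ := x)
    (P := fun y p => p ∉ superdiff v y) (by
      intro p hp
      exact h.isClosed_graph.isOpen_compl.mem_nhds fun hmem => hp.2 (hx hmem))
  filter_upwards [this] with y hy p hp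
  by_contra hpO
  exact hy p ⟨by simpa using h.norm_le y p hp, hpO⟩ hp

/-- At a point where its superdifferential is a singleton, a semiconcave function is
differentiable. -/
theorem mem_subdiff_of_superdiff_eq_singleton (h : IsLipschitzSemiconcave v P C) {p : RSpace n}
    (hp : superdiff v x = {p}) : p ∈ subdiff v x := by
  intro ε hε
  have hC : 0 < C + 1 := by linarith [h.nonneg]
  have h1 := h.eventually_superdiff x (O := Metric.ball p (ε / 2)) Metric.isOpen_ball
    (by rw [hp]; simpa using hε)
  have h2 : ∀ᶠ y in 𝓝 x, ‖y - x‖ < ε / 2 / (C + 1) := by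
    filter_upwards [Metric.ball_mem_nhds x (div_pos (half_pos hε) hC)] with y hy
    rwa [← dist_eq_norm]
  filter_upwards [h1, h2] with y hy1 hy2
  obtain ⟨q, hq⟩ := h.nonempty_superdiff y
  have h3 := h.le_of_mem_superdiff hq x
  have h4 : ‖q - p‖ < ε / 2 := by simpa [dist_eq_norm] using hy1 hq
  have h5 := (abs_le.1 (abs_real_inner_le_norm (q - p) (y - x))).1
  rw [← neg_sub y x, inner_neg_right, norm_neg] at h3
  rw [inner_sub_left] at h5
  rw [lt_div_iff₀ hC] at hy2
  have h6 := mul_le_mul_of_nonneg_right h4.le (norm_nonneg (y - x))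
  nlinarith [norm_nonneg (y - x)]

/-- Supergradients of a semiconcave function are monotone up to a quadratic error. -/
theorem inner_sub_le (h : IsLipschitzSemiconcave v P C) {y p q : RSpace n}
    (hp : p ∈ superdiff v x) (hq : q ∈ superdiff v y) :
    inner ℝ (y - x) (q - p) ≤ 2 * C * ‖y - x‖ ^ 2 := by
  have h1 := h.le_of_mem_superdiff hp y
  have h2 := h.le_of_mem_superdiff hq x
  rw [← neg_sub y x, inner_neg_right, norm_neg] at h2
  rw [inner_sub_right, real_inner_comm, real_inner_comm p]
  linarith

/-- The supergradient of least energy `⟨B x p, p⟩`, with its variational inequality. -/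
theorem exists_minimal (h : IsLipschitzSemiconcave v P C) {B : RSpace n → RSpace n →L[ℝ] RSpace n}
    {l K : ℝ} (hB : IsUniformCometric B l K) (x : RSpace n) :
    ∃ p ∈ superdiff v x, ∀ q ∈ superdiff v x, 0 ≤ inner ℝ (B x p) (q - p) := by
  obtain ⟨p, hp, hmin⟩ := (h.isCompact_superdiff x).exists_isMinOn (h.nonempty_superdiff x)
    (f := fun p => inner ℝ (B x p) p) (by fun_prop)
  refine ⟨p, hp, fun q hq => ?_⟩
  by_contra hneg
  push Not at hneg
  set b := inner ℝ (B x p) (q - p) with hb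
  set D := inner ℝ (B x (q - p)) (q - p) with hD
  have hD0 : 0 ≤ D := (by have := hB.pos; positivity : 0 ≤ l * ‖q - p‖ ^ 2).trans
    (hB.elliptic x (q - p))
  have hkey : ∀ t : ℝ, 0 ≤ t → t ≤ 1 → 0 ≤ 2 * t * b + t ^ 2 * D := by
    intro t ht0 ht1
    have hm : p + t • (q - p) ∈ superdiff v x := by
      have := h.convex_superdiff x hp hq (by linarith : 0 ≤ 1 - t) ht0 (by ring)
      convert this using 1
      module
    have h1 : inner ℝ (B x p) p ≤ inner ℝ (B x (p + t • (q - p))) (p + t • (q - p)) := hmin hm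
    have hs : inner ℝ (B x (q - p)) p = b := by rw [hB.symm, real_inner_comm]
    rw [map_add, map_smul, inner_add_left, inner_add_right, inner_add_right, inner_smul_left,
      inner_smul_left, inner_smul_right, inner_smul_right, hs, ← hb, ← hD] at h1
    simp only [conj_trivial] at h1
    linarith
  -- The choice `t = -b / (D - b)` makes the quadratic negative.
  have hDb : 0 < D - b := by linarith
  have h1 := hkey (-b / (D - b)) (div_nonneg (by linarith) hDb.le)
    ((div_le_one hDb).2 (by linarith))
  have h2 : 2 * (-b / (D - b)) * b + (-b / (D - b)) ^ 2 * D =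
      (b ^ 2 / (D - b) ^ 2) * (2 * b - D) := by
    field_simp
    ring
  rw [h2] at h1
  have h3 : 0 < b ^ 2 / (D - b) ^ 2 := by have : b ≠ 0 := hneg.ne; positivity
  nlinarith

end IsLipschitzSemiconcave

/-! ### Existence of generalized characteristics -/

section Euler

variable {n : ℕ}

/-- The Euler polygon with vertices `eulerPoint W x₀ h k` and step `h` for the field `W`. -/
noncomputable def eulerPoint (W : RSpace n → RSpace n) (x₀ : RSpace n) (h : ℝ) : ℕ → RSpace n
  | 0 => x₀
  | k + 1 => eulerPoint W x₀ h k + h • W (eulerPoint W x₀ h k)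

variable {W : RSpace n → RSpace n} {x₀ : RSpace n} {h S : ℝ}

theorem norm_eulerPoint_sub_le (hW : ∀ y, ‖W y‖ ≤ S) (hh : 0 ≤ h) (i k : ℕ) :
    ‖eulerPoint W x₀ h (i + k) - eulerPoint W x₀ h i‖ ≤ k * h * S := by
  induction k with
  | zero => simp
  | succ k ih =>
    have e : eulerPoint W x₀ h (i + (k + 1)) - eulerPoint W x₀ h i =
        (eulerPoint W x₀ h (i + k) - eulerPoint W x₀ h i) +
          h • W (eulerPoint W x₀ h (i + k)) := by
      rw [← add_assoc, eulerPoint]; abel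
    rw [e]
    refine (norm_add_le _ _).trans ?_
    rw [norm_smul, Real.norm_eq_abs, abs_of_nonneg hh]
    have := mul_le_mul_of_nonneg_left (hW (eulerPoint W x₀ h (i + k))) hh
    push_cast
    linarith

/-- Increments of an Euler polygon are averages of the velocities it meets. -/
theorem exists_eulerPoint_sub_eq {T : Set (RSpace n)} (hT : Convex ℝ T) (i k : ℕ)
    (hmem : ∀ j < k + 1, W (eulerPoint W x₀ h (i + j)) ∈ T) :
    ∃ z ∈ T, eulerPoint W x₀ h (i + (k + 1)) - eulerPoint W x₀ h i =
      (((k + 1 : ℕ) : ℝ) * h) • z := by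
  induction k with
  | zero =>
    refine ⟨_, hmem 0 (by omega), ?_⟩
    simp [eulerPoint]
  | succ k ih =>
    obtain ⟨z, hz, he⟩ := ih fun j hj => hmem j (by omega)
    have hk : (0 : ℝ) < k + 1 + 1 := by positivity
    refine ⟨_, hT hz (hmem (k + 1) (by omega))
      (by positivity : (0 : ℝ) ≤ (k + 1) / (k + 1 + 1)) (by positivity : 0 ≤ 1 / ((k : ℝ) + 1 + 1))
      (by field_simp), ?_⟩
    have e : eulerPoint W x₀ h (i + (k + 1 + 1)) - eulerPoint W x₀ h i =
        (eulerPoint W x₀ h (i + (k + 1)) - eulerPoint W x₀ h i) +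
          h • W (eulerPoint W x₀ h (i + (k + 1))) := by
      rw [← add_assoc, eulerPoint]; abel
    rw [e, he, smul_add, smul_smul, smul_smul]
    push_cast
    congr 2 <;> field_simp

theorem floor_mul_sub_le {m s t : ℝ} (hm : 0 < m) (hs : 0 ≤ s) (hst : s ≤ t) :
    |((⌊t * m⌋₊ : ℝ) - ⌊s * m⌋₊) * m⁻¹ - (t - s)| ≤ m⁻¹ := by
  have h1 := Nat.floor_le (mul_nonneg hs hm.le)
  have h2 := Nat.lt_floor_add_one (s * m)
  have h3 := Nat.floor_le (mul_nonneg (hs.trans hst) hm.le)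
  have h4 := Nat.lt_floor_add_one (t * m)
  have e : ((⌊t * m⌋₊ : ℝ) - ⌊s * m⌋₊) * m⁻¹ - (t - s) =
      ((⌊t * m⌋₊ - t * m) - (⌊s * m⌋₊ - s * m)) * m⁻¹ := by field_simp; ring
  rw [e, abs_mul, abs_of_pos (inv_pos.2 hm)]
  refine mul_le_of_le_one_left (inv_pos.2 hm).le ?_
  rw [abs_le]
  constructor <;> linarith

/-- The limit, along an ultrafilter, of Euler polygons of a bounded field `W` whose values near `x`
are, for every `x`, close to a compact convex set `Γ x`. -/
theorem exists_eulerLimit (hW : ∀ y, ‖W y‖ ≤ S) {Γ : RSpace n → Set (RSpace n)}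
    (hconv : ∀ x, Convex ℝ (Γ x)) (hcomp : ∀ x, IsCompact (Γ x))
    (husc : ∀ x, ∀ η > 0, ∀ᶠ y in 𝓝 x, W y ∈ Metric.cthickening η (Γ x)) (x₀ : RSpace n) :
    ∃ γ : ℝ → RSpace n, γ 0 = x₀ ∧ (∀ s t, 0 ≤ s → s ≤ t → ‖γ t - γ s‖ ≤ S * (t - s)) ∧
      ∀ s, 0 ≤ s → ∀ w, HasDerivAt γ w s → w ∈ Γ (γ s) := by
  have hS0 : 0 ≤ S := (norm_nonneg _).trans (hW 0)
  set H : ℕ → ℝ := fun m => ((m : ℝ) + 1)⁻¹ with hH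
  have hH0 : ∀ m, 0 < H m := fun m => by positivity
  have hHinv : ∀ m, (H m)⁻¹ = (m : ℝ) + 1 := fun m => by simp [hH]
  set U : Ultrafilter ℕ := hyperfilter ℕ
  have hUtop : (U : Filter ℕ) ≤ atTop := Nat.hyperfilter_le_atTop
  have hHlim : Tendsto H U (𝓝 0) := by
    have := (tendsto_one_div_add_atTop_nhds_zero_nat (𝕜 := ℝ)).mono_left hUtop
    simpa [hH] using this
  set ι : ℕ → ℝ → ℕ := fun m s => ⌊s * ((m : ℝ) + 1)⌋₊ with hι
  have hιmono : ∀ m s t, s ≤ t → ι m s ≤ ι m t := fun m s t hst =>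
    Nat.floor_mono (mul_le_mul_of_nonneg_right hst (by positivity))
  have hιsub : ∀ m s t, 0 ≤ s → s ≤ t →
      |((ι m t : ℝ) - ι m s) * H m - (t - s)| ≤ H m := fun m s t hs hst =>
    floor_mul_sub_le (by positivity) hs hst
  set g : ℕ → ℝ → RSpace n := fun m s => eulerPoint W x₀ (H m) (ι m s) with hg
  have hgsub : ∀ m s t, 0 ≤ s → s ≤ t → ‖g m t - g m s‖ ≤ S * (t - s + H m) := by
    intro m s t hs hst
    obtain ⟨k, hk⟩ := Nat.exists_eq_add_of_le (hιmono m s t hst)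
    have h1 := norm_eulerPoint_sub_le (x₀ := x₀) hW (hH0 m).le (ι m s) k
    have h2 := (abs_le.1 (hιsub m s t hs hst)).2
    rw [hk] at h2
    push_cast at h2
    simp only [hg, hk]
    refine h1.trans ?_
    rw [mul_comm]
    exact mul_le_mul_of_nonneg_left (by linarith) hS0
  have hg0 : ∀ m, g m 0 = x₀ := fun m => by simp [hg, hι, eulerPoint]
  have hH1 : ∀ m, H m ≤ 1 := fun m => inv_le_one_of_one_le₀ (by linarith [m.cast_nonneg (α := ℝ)])
  have hlim : ∀ s, ∃ y, 0 ≤ s → Tendsto (fun m => g m s) U (𝓝 y) := by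
    intro s
    by_cases hs : 0 ≤ s
    · have hball : ∀ m, g m s ∈ Metric.closedBall x₀ (S * (s + 1)) := by
        intro m
        rw [mem_closedBall_iff_norm, ← hg0 m]
        refine (hgsub m 0 s le_rfl hs).trans (mul_le_mul_of_nonneg_left ?_ hS0)
        linarith [hH1 m]
      obtain ⟨y, -, hy⟩ := (isCompact_closedBall x₀ (S * (s + 1))).ultrafilter_le_nhds'
        (U.map fun m => g m s) (Ultrafilter.mem_map.2 (univ_mem' hball))
      exact ⟨y, fun _ => hy⟩
    · exact ⟨0, fun h => absurd h hs⟩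
  choose γ hγ using hlim
  have hγlip : ∀ s t, 0 ≤ s → s ≤ t → ‖γ t - γ s‖ ≤ S * (t - s) := by
    intro s t hs hst
    refine le_of_tendsto_of_tendsto ((hγ t (hs.trans hst)).sub (hγ s hs)).norm ?_
      (Eventually.of_forall fun m => hgsub m s t hs hst)
    simpa using (hHlim.const_add (t - s)).const_mul S
  have hγ0 : γ 0 = x₀ := by
    refine tendsto_nhds_unique (hγ 0 le_rfl) ?_
    simp only [hg0]
    exact tendsto_const_nhds
  refine ⟨γ, hγ0, hγlip, fun s hs w hw => ?_⟩
  have hmem : ∀ η : ℝ, 0 < η → w ∈ Metric.cthickening η (Γ (γ s)) := by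
    intro η hη
    set T := Metric.cthickening η (Γ (γ s)) with hT
    obtain ⟨δ, hδ, hball⟩ := Metric.eventually_nhds_iff_ball.1 (husc (γ s) η hη)
    have hslope : Tendsto (slope γ s) (𝓝[>] s) (𝓝 w) :=
      (hasDerivAt_iff_tendsto_slope.1 hw).mono_left
        (nhdsWithin_mono s fun t (ht : s < t) => ht.ne')
    refine Metric.isClosed_cthickening.mem_of_tendsto hslope ?_
    set r : ℝ := δ / 4 / (S + 1) with hr
    have hr0 : 0 < r := by positivity
    have hSr : S * r ≤ δ / 4 := by
      rw [hr, mul_div_assoc', div_le_iff₀ (by linarith)]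
      nlinarith
    filter_upwards [Ioo_mem_nhdsGT (by linarith : s < s + r)] with t ht
    have hst : s < t := ht.1
    have htend : Tendsto (fun m => ((ι m t : ℝ) - ι m s) * H m) U (𝓝 (t - s)) := by
      rw [tendsto_iff_norm_sub_tendsto_zero]
      exact squeeze_zero (fun _ => norm_nonneg _) (fun m => hιsub m s t hs hst.le) hHlim
    have hpos : ∀ᶠ m in U, 0 < ((ι m t : ℝ) - ι m s) * H m :=
      htend.eventually (lt_mem_nhds (by linarith))
    have hnear : ∀ᶠ m in U, ‖g m s - γ s‖ < δ / 4 := by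
      have := (tendsto_iff_norm_sub_tendsto_zero.1 (hγ s hs)).eventually
        (gt_mem_nhds (by positivity : 0 < δ / 4))
      exact this
    have hHr : ∀ᶠ m in U, H m < r := hHlim.eventually (gt_mem_nhds hr0)
    have hquot : Tendsto (fun m => (((ι m t : ℝ) - ι m s) * H m)⁻¹ • (g m t - g m s)) U
        (𝓝 ((t - s)⁻¹ • (γ t - γ s))) :=
      (htend.inv₀ (by linarith)).smul ((hγ t (hs.trans hst.le)).sub (hγ s hs))
    rw [slope_def_module]
    refine Metric.isClosed_cthickening.mem_of_tendsto hquot ?_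
    filter_upwards [hpos, hnear, hHr] with m hm1 hm2 hm3
    have hlt : ι m s < ι m t := by
      have : (0 : ℝ) < (ι m t : ℝ) - ι m s := pos_of_mul_pos_left hm1 (hH0 m).le
      exact_mod_cast sub_pos.1 this
    obtain ⟨k, hk⟩ := Nat.exists_eq_add_of_lt hlt
    rw [add_assoc] at hk
    obtain ⟨z, hz, he⟩ := exists_eulerPoint_sub_eq (W := W) (x₀ := x₀) (h := H m)
      ((hconv (γ s)).cthickening η) (ι m s) k (by
        intro j hj
        refine hball _ ?_
        rw [mem_ball_iff_norm]
        have h1 := norm_eulerPoint_sub_le (x₀ := x₀) hW (hH0 m).le (ι m s) j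
        have h2 := (abs_le.1 (hιsub m s t hs hst.le)).2
        rw [hk] at h2
        push_cast at h2
        have h3 : (j : ℝ) ≤ k + 1 := by exact_mod_cast hj.le
        have h4 : (j : ℝ) * H m ≤ (k + 1) * H m := mul_le_mul_of_nonneg_right h3 (hH0 m).le
        have h5 : (j : ℝ) * H m ≤ r + r := by linarith [ht.2]
        have h6 := mul_le_mul_of_nonneg_right h5 hS0
        have h7 : eulerPoint W x₀ (H m) (ι m s + j) - γ s =
            (eulerPoint W x₀ (H m) (ι m s + j) - eulerPoint W x₀ (H m) (ι m s)) +
              (g m s - γ s) := by simp only [hg]; abel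
        rw [h7]
        refine (norm_add_le _ _).trans_lt ?_
        linarith)
    have hcoef : ((ι m t : ℝ) - ι m s) = ((k + 1 : ℕ) : ℝ) := by
      rw [hk]; push_cast; ring
    have hne : ((k + 1 : ℕ) : ℝ) * H m ≠ 0 := by
      have := hH0 m
      positivity
    simp only [hg, hcoef]
    rw [hk, he, smul_smul, inv_mul_cancel₀ hne, one_smul]
    exact hz
  have := (hcomp (γ s)).isClosed.closure_eq
  rw [← this, Metric.closure_eq_iInter_cthickening]
  exact mem_iInter₂.2 hmem

end Euler

section Arc

variable {n : ℕ} {v : RSpace n → ℝ} {P C l K : ℝ} {B : RSpace n → RSpace n →L[ℝ] RSpace n}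

theorem IsUniformCometric.norm_apply_le (hB : IsUniformCometric B l K)
    (h : IsLipschitzSemiconcave v P C) {x p : RSpace n} (hp : p ∈ superdiff v x) (y : RSpace n) :
    ‖B y p‖ ≤ K * P :=
  ((B y).le_opNorm p).trans
    (mul_le_mul (hB.norm_le y) (h.norm_le x p hp) (norm_nonneg _) hB.nonneg)

/-- `γ` is a forward arc on `[0, ∞)` of the differential inclusion `γ' ∈ B(γ) D⁺v(γ)`, with speed
at most `S`; the inclusion is required wherever `γ` is differentiable. -/
structure IsGradientArc (B : RSpace n → RSpace n →L[ℝ] RSpace n) (v : RSpace n → ℝ) (S : ℝ)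
    (γ : ℝ → RSpace n) : Prop where
  lipschitz : ∀ s t, 0 ≤ s → s ≤ t → ‖γ t - γ s‖ ≤ S * (t - s)
  inclusion : ∀ s, 0 ≤ s → ∀ w, HasDerivAt γ w s → w ∈ B (γ s) '' superdiff v (γ s)

theorem IsLipschitzSemiconcave.exists_characteristic (h : IsLipschitzSemiconcave v P C)
    (hB : IsUniformCometric B l K) (x₀ : RSpace n) :
    ∃ γ : ℝ → RSpace n, γ 0 = x₀ ∧ IsGradientArc B v (K * P) γ := by
  choose q hq using h.nonempty_superdiff
  have hconv : ∀ x, Convex ℝ (B x '' superdiff v x) := fun x =>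
    (h.convex_superdiff x).is_linear_image (B x).isBoundedLinearMap.toIsLinearMap
  have hcomp : ∀ x, IsCompact (B x '' superdiff v x) := fun x =>
    (h.isCompact_superdiff x).image (B x).continuous
  have hW : ∀ y, ‖B y (q y)‖ ≤ K * P := fun y => hB.norm_apply_le h (hq y) y
  have husc : ∀ x, ∀ η : ℝ, 0 < η → ∀ᶠ y in 𝓝 x,
      B y (q y) ∈ Metric.cthickening η (B x '' superdiff v x) := by
    intro x η hη
    have hsub : superdiff v x ⊆ B x ⁻¹' Metric.thickening (η / 2) (B x '' superdiff v x) :=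
      image_subset_iff.1 (Metric.self_subset_thickening (half_pos hη) _)
    have h1 := h.eventually_superdiff x
      (Metric.isOpen_thickening.preimage (B x).continuous) hsub
    have h2 : ∀ᶠ y in 𝓝 x, K * ‖y - x‖ * P < η / 2 := by
      have hc : Continuous fun y : RSpace n => K * ‖y - x‖ * P := by fun_prop
      have := hc.tendsto x
      simp only [sub_self, norm_zero, mul_zero, zero_mul] at this
      exact this.eventually (gt_mem_nhds (half_pos hη))
    filter_upwards [h1, h2] with y hy1 hy2
    have h3 := hy1 (hq y)
    rw [mem_preimage, Metric.mem_thickening_iff] at h3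
    obtain ⟨z, hz, hd⟩ := h3
    refine Metric.thickening_subset_cthickening _ _ (Metric.mem_thickening_iff.2 ⟨z, hz, ?_⟩)
    have h4 : dist (B y (q y)) (B x (q y)) ≤ K * ‖y - x‖ * P := by
      rw [dist_eq_norm, ← _root_.sub_apply]
      refine ((B y - B x).le_opNorm _).trans ?_
      exact mul_le_mul (hB.lipschitz y x) (h.norm_le y _ (hq y)) (norm_nonneg _)
        (mul_nonneg hB.nonneg (norm_nonneg _))
    linarith [dist_triangle (B y (q y)) (B x (q y)) z]
  obtain ⟨γ, h0, h1, h2⟩ := exists_eulerLimit hW hconv hcomp husc x₀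
  exact ⟨γ, h0, h1, h2⟩

end Arc

/-! ### Right derivatives and growth of the energy -/

theorem LipschitzOnWith.ae_differentiableAt_Ioo {n : ℕ} {γ : ℝ → RSpace n} {L : NNReal} {a b : ℝ}
    (hγ : LipschitzOnWith L γ (Icc a b)) :
    ∀ᵐ s ∂(volume.restrict (Icc a b)), s ∈ Ioo a b ∧ DifferentiableAt ℝ γ s := by
  rw [← restrict_Ioo_eq_restrict_Icc, ae_restrict_iff' measurableSet_Ioo]
  filter_upwards [(hγ.mono Ioo_subset_Icc_self).ae_differentiableWithinAt_of_mem_real] with s hs hm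
  exact ⟨hm, (hs hm).differentiableAt (Ioo_mem_nhds hm.1 hm.2)⟩

theorem LipschitzOnWith.exists_comp_contDiff {n : ℕ} {γ : ℝ → RSpace n} {L : NNReal} {a b : ℝ}
    (hγ : LipschitzOnWith L γ (Icc a b)) {Q : RSpace n × ℝ → ℝ} (hQ : ContDiff ℝ 1 Q) :
    ∃ L', LipschitzOnWith L' (fun t => Q (γ t, t)) (Icc a b) := by
  have h1 : LipschitzOnWith (max L 1) (fun t => (γ t, t)) (Icc a b) :=
    hγ.prodMk (LipschitzWith.id.lipschitzOnWith)
  obtain ⟨L₁, hL₁⟩ := (hQ.locallyLipschitz.locallyLipschitzOn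
    (s := (fun t => (γ t, t)) '' Icc a b)).exists_lipschitzOnWith_of_compact
      (isCompact_Icc.image_of_continuousOn h1.continuousOn)
  exact ⟨_, hL₁.comp h1 (mapsTo_image _ _)⟩

section RightDerivative

variable {n : ℕ} {v : RSpace n → ℝ} {P C l K κ : ℝ} {B G : RSpace n → RSpace n →L[ℝ] RSpace n}

/-- `G` is the field of metrics on vectors dual to the field `B` of metrics on covectors, with
bounds `κ` on `G` and its derivative. -/
structure IsDualMetric (B G : RSpace n → RSpace n →L[ℝ] RSpace n) (κ : ℝ) : Prop where
  symm : ∀ x p q, inner ℝ (G x p) q = inner ℝ p (G x q)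
  left_inv : ∀ x p, G x (B x p) = p
  right_inv : ∀ x e, B x (G x e) = e
  nonneg : 0 ≤ κ
  norm_le : ∀ x, ‖G x‖ ≤ κ
  differentiable : Differentiable ℝ G
  fderiv_le : ∀ x, ‖fderiv ℝ G x‖ ≤ κ

theorem IsDualMetric.norm_sq_le (hG : IsDualMetric B G κ) (hB : IsUniformCometric B l K)
    (x e : RSpace n) : l * ‖e‖ ^ 2 ≤ K ^ 2 * inner ℝ (G x e) e := by
  have h1 : ‖e‖ ≤ K * ‖G x e‖ := by
    calc ‖e‖ = ‖B x (G x e)‖ := by rw [hG.right_inv]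
      _ ≤ ‖B x‖ * ‖G x e‖ := (B x).le_opNorm _
      _ ≤ _ := mul_le_mul_of_nonneg_right (hB.norm_le x) (norm_nonneg _)
  have h2 := hB.elliptic x (G x e)
  rw [hG.right_inv, real_inner_comm] at h2
  have h3 : ‖e‖ ^ 2 ≤ (K * ‖G x e‖) ^ 2 := by gcongr
  calc l * ‖e‖ ^ 2 ≤ l * (K * ‖G x e‖) ^ 2 := mul_le_mul_of_nonneg_left h3 hB.pos.le
    _ = K ^ 2 * (l * ‖G x e‖ ^ 2) := by ring
    _ ≤ _ := mul_le_mul_of_nonneg_left h2 (sq_nonneg K)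

/-- Variation of the direction `B y q` along the base point. -/
theorem IsDualMetric.inner_apply_sub_le (hG : IsDualMetric B G κ) (hB : IsUniformCometric B l K)
    (h : IsLipschitzSemiconcave v P C) {x y p q : RSpace n} (hq : q ∈ superdiff v y)
    (e : RSpace n) :
    inner ℝ (G x e) (B y q - B x p) ≤ inner ℝ e (q - p) + κ * ‖e‖ * (K * ‖y - x‖ * P) := by
  have e1 : B y q - B x p = B x (q - p) + (B y - B x) q := by
    rw [map_sub, _root_.sub_apply]; abel
  rw [e1, inner_add_right, hG.symm, hG.left_inv]
  have h1 : ‖(B y - B x) q‖ ≤ K * ‖y - x‖ * P :=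
    ((B y - B x).le_opNorm q).trans (mul_le_mul (hB.lipschitz y x) (h.norm_le y q hq)
      (norm_nonneg _) (mul_nonneg hB.nonneg (norm_nonneg _)))
  have h2 : ‖G x e‖ ≤ κ * ‖e‖ :=
    ((G x).le_opNorm e).trans (mul_le_mul_of_nonneg_right (hG.norm_le x) (norm_nonneg _))
  have h3 := (real_inner_le_norm (G x e) ((B y - B x) q)).trans
    (mul_le_mul h2 h1 (norm_nonneg _) (mul_nonneg hG.nonneg (norm_nonneg _)))
  linarith

theorem IsGradientArc.lipschitzOnWith {S : ℝ} {γ : ℝ → RSpace n} (hγ : IsGradientArc B v S γ)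
    {a b : ℝ} (ha : 0 ≤ a) : LipschitzOnWith S.toNNReal γ (Icc a b) := by
  refine LipschitzOnWith.of_dist_le_mul fun s hs t ht => ?_
  have hle : ∀ s t : ℝ, 0 ≤ s → s ≤ t → ‖γ t - γ s‖ ≤ S.toNNReal * (t - s) := fun s t h0 hst =>
    (hγ.lipschitz s t h0 hst).trans
      (mul_le_mul_of_nonneg_right (Real.le_coe_toNNReal S) (sub_nonneg.2 hst))
  rcases le_total s t with hst | hst
  · rw [dist_comm, dist_comm s, dist_eq_norm, Real.dist_eq, abs_of_nonneg (sub_nonneg.2 hst)]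
    exact hle s t (ha.trans hs.1) hst
  · rw [dist_eq_norm, Real.dist_eq, abs_of_nonneg (sub_nonneg.2 hst)]
    exact hle t s (ha.trans ht.1) hst

/-- A forward arc has a right derivative at every time, given by the minimal supergradient `p`.
In the frozen metric `G (γ s)`, the squared distance `f` of `γ t` to `γ s + (t - s) B p` satisfies
`f' ≤ o(t - s)` by monotonicity and upper semicontinuity of the superdifferential. -/
theorem IsGradientArc.hasDerivWithinAt (hB : IsUniformCometric B l K) (hG : IsDualMetric B G κ)
    (h : IsLipschitzSemiconcave v P C) {γ : ℝ → RSpace n} (hγ : IsGradientArc B v (K * P) γ)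
    {s : ℝ} (hs : 0 ≤ s) {p : RSpace n} (hp : p ∈ superdiff v (γ s))
    (hmin : ∀ q ∈ superdiff v (γ s), 0 ≤ inner ℝ (B (γ s) p) (q - p)) :
    HasDerivWithinAt γ (B (γ s) p) (Ici s) s := by
  set x := γ s with hx
  set w := B x p with hw
  set S := K * P with hS
  have hP0 : 0 ≤ P := (norm_nonneg p).trans (h.norm_le x p hp)
  have hS0 : 0 ≤ S := mul_nonneg hB.nonneg hP0
  have hwS : ‖w‖ ≤ S := hB.norm_apply_le h hp x
  set e : ℝ → RSpace n := fun t => γ t - x - (t - s) • w with he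
  have hγS : ∀ t, s ≤ t → ‖γ t - x‖ ≤ S * (t - s) := fun t ht => hγ.lipschitz s t hs ht
  have heS : ∀ t, s ≤ t → ‖e t‖ ≤ 2 * S * (t - s) := by
    intro t ht
    refine (norm_sub_le _ _).trans ?_
    rw [norm_smul, Real.norm_eq_abs, abs_of_nonneg (sub_nonneg.2 ht)]
    have := mul_le_mul_of_nonneg_left hwS (sub_nonneg.2 ht)
    linarith [hγS t ht]
  set c : ℝ := 4 * C * S ^ 2 + 4 * κ * S * (K * S * P) with hc
  have hc0 : 0 ≤ c := by
    have := h.nonneg; have := hG.nonneg; have := hB.nonneg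
    positivity
  have hmain : ∀ ε : ℝ, 0 < ε → ∃ r > 0, ∀ t, s ≤ t → t < s + r →
      inner ℝ (G x (e t)) (e t) ≤ 2 * ε * (t - s) ^ 2 := by
    intro ε hε
    have husc := h.eventually_superdiff x (O := {q | -ε < inner ℝ w (q - p)})
      (isOpen_lt continuous_const (by fun_prop)) fun q hq => by
        have := hmin q hq
        simp only [mem_ofPred_eq]
        linarith
    obtain ⟨δ, hδ, hball⟩ := Metric.eventually_nhds_iff_ball.1 husc
    refine ⟨min (δ / (S + 1)) (ε / (c + 1)), by positivity, fun t hst htr => ?_⟩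
    have hr1 : t - s < δ / (S + 1) := by linarith [min_le_left (δ / (S + 1)) (ε / (c + 1))]
    have hr2 : t - s < ε / (c + 1) := by linarith [min_le_right (δ / (S + 1)) (ε / (c + 1))]
    rw [lt_div_iff₀ (by linarith)] at hr1 hr2
    obtain ⟨L', hL'⟩ := (hγ.lipschitzOnWith (b := t) hs).exists_comp_contDiff
      (Q := fun z => inner ℝ (G x (z.1 - x - (z.2 - s) • w)) (z.1 - x - (z.2 - s) • w)
        - 2 * ε * (z.2 - s) ^ 2)
      (by
        have h1 : ContDiff ℝ 1 fun z : RSpace n × ℝ => z.1 - x - (z.2 - s) • w := by fun_prop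
        exact (((G x).contDiff.comp h1).inner ℝ h1).sub (by fun_prop))
    have hle := hL'.le_of_ae_hasDerivAt_nonpos hst (by
      filter_upwards [(hγ.lipschitzOnWith (b := t) hs).ae_differentiableAt_Ioo] with τ hτ d hd
      obtain ⟨⟨hsτ, hτt⟩, hdiff⟩ := hτ
      obtain ⟨q, hq, hqw⟩ := hγ.inclusion τ (hs.trans hsτ.le) _ hdiff.hasDerivAt
      have hγ' : HasDerivAt γ (B (γ τ) q) τ := by rw [hqw]; exact hdiff.hasDerivAt
      have he' : HasDerivAt e (B (γ τ) q - w) τ := by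
        have h1 := (hγ'.sub_const x).sub (((hasDerivAt_id τ).sub_const s).smul_const w)
        rw [one_smul] at h1
        exact h1
      have hGe : HasDerivAt (fun t => G x (e t)) (G x (B (γ τ) q - w)) τ :=
        (G x).hasFDerivAt.comp_hasDerivAt τ he'
      have hsq : HasDerivAt (fun t : ℝ => 2 * ε * (t - s) ^ 2) (2 * ε * (2 * (τ - s))) τ := by
        have := (((hasDerivAt_id τ).sub_const s).pow 2).const_mul (2 * ε)
        simpa using this
      have hf := (hGe.inner ℝ he').sub hsq
      have hdeq := hd.unique hf
      rw [hdeq]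
      have e1 : inner ℝ (G x (B (γ τ) q - w)) (e τ) = inner ℝ (G x (e τ)) (B (γ τ) q - w) := by
        rw [hG.symm, real_inner_comm]
      have h1 := hG.inner_apply_sub_le hB h hq (x := x) (p := p) (e τ)
      rw [← hw] at h1
      have hσ : 0 < τ - s := by linarith
      have h2 := h.inner_sub_le hp hq
      have h3 : -ε < inner ℝ w (q - p) := by
        refine hball (γ τ) ?_ hq
        rw [mem_ball_iff_norm]
        refine (hγS τ hsτ.le).trans_lt ?_
        have : S * (τ - s) ≤ S * (t - s) := mul_le_mul_of_nonneg_left (by linarith) hS0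
        linarith
      have h4 : inner ℝ (e τ) (q - p) =
          inner ℝ (γ τ - x) (q - p) - (τ - s) * inner ℝ w (q - p) := by
        simp only [he]
        rw [inner_sub_left (γ τ - x), inner_smul_left]
        simp
      have h5 : 2 * C * ‖γ τ - x‖ ^ 2 ≤ 2 * C * (S * (τ - s)) ^ 2 := by
        have := hγS τ hsτ.le
        have := h.nonneg
        gcongr
      have h6 : κ * ‖e τ‖ * (K * ‖γ τ - x‖ * P) ≤
          κ * (2 * S * (τ - s)) * (K * (S * (τ - s)) * P) := by
        have := hγS τ hsτ.le
        have := heS τ hsτ.le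
        have := hG.nonneg
        have := hB.nonneg
        gcongr
      have h7 : (τ - s) * -ε ≤ (τ - s) * inner ℝ w (q - p) :=
        mul_le_mul_of_nonneg_left h3.le hσ.le
      have h8 : c * (τ - s) ^ 2 ≤ ε * (τ - s) := by
        have h : (τ - s) * (c + 1) ≤ (t - s) * (c + 1) :=
          mul_le_mul_of_nonneg_right (by linarith) (by linarith)
        rw [sq, ← mul_assoc]
        exact mul_le_mul_of_nonneg_right (by linarith) hσ.le
      have h9 : 2 * (2 * C * (S * (τ - s)) ^ 2) +
          2 * (κ * (2 * S * (τ - s)) * (K * (S * (τ - s)) * P)) = c * (τ - s) ^ 2 := by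
        rw [hc]; ring
      have h10 : 0 < ε * (τ - s) := mul_pos hε hσ
      rw [e1]
      linarith)
    have hes : e s = 0 := by simp [he, hx]
    change inner ℝ (G x (e t)) (e t) - 2 * ε * (t - s) ^ 2 ≤
      inner ℝ (G x (e s)) (e s) - 2 * ε * (s - s) ^ 2 at hle
    rw [hes] at hle
    simp at hle
    linarith
  rw [hasDerivWithinAt_iff_isLittleO, Asymptotics.isLittleO_iff]
  intro η hη
  have hl := hB.pos
  obtain ⟨r, hr, hle⟩ := hmain (l * η ^ 2 / (2 * (K ^ 2 + 1))) (by positivity)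
  filter_upwards [Ico_mem_nhdsGE (by linarith : s < s + r)] with t ht
  have h1 := hG.norm_sq_le hB x (e t)
  have h2 := mul_le_mul_of_nonneg_left (hle t ht.1 ht.2) (sq_nonneg K)
  have h3 : K ^ 2 * (2 * (l * η ^ 2 / (2 * (K ^ 2 + 1))) * (t - s) ^ 2) ≤
      l * (η * (t - s)) ^ 2 := by
    have : K ^ 2 * (2 * (l * η ^ 2 / (2 * (K ^ 2 + 1))) * (t - s) ^ 2) =
        (l * (η * (t - s)) ^ 2) * (K ^ 2 / (K ^ 2 + 1)) := by field_simp
    rw [this]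
    exact mul_le_of_le_one_right (by positivity) ((div_le_one (by positivity)).2 (by linarith))
  have h4 : ‖e t‖ ^ 2 ≤ (η * (t - s)) ^ 2 := le_of_mul_le_mul_left (by linarith) hl
  rw [Real.norm_eq_abs, abs_of_nonneg (sub_nonneg.2 ht.1)]
  exact le_of_sq_le_sq h4 (mul_nonneg hη.le (sub_nonneg.2 ht.1))

/-- Along a forward arc the energy `⟨B p, p⟩` of the minimal supergradient grows at most
exponentially: the metric distance between the arc and its time translates satisfies a Gronwall
estimate, which is divided by the translation. -/
theorem IsGradientArc.exists_energy_le (hB : IsUniformCometric B l K) (hG : IsDualMetric B G κ)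
    (h : IsLipschitzSemiconcave v P C) {γ : ℝ → RSpace n} (hγ : IsGradientArc B v (K * P) γ)
    {p : ℝ → RSpace n} (hp : ∀ s, 0 ≤ s → p s ∈ superdiff v (γ s))
    (hderiv : ∀ s, 0 ≤ s → HasDerivWithinAt γ (B (γ s) (p s)) (Ici s) s) :
    ∃ c, ∀ t, 0 ≤ t → inner ℝ (B (γ t) (p t)) (p t) ≤
      inner ℝ (B (γ 0) (p 0)) (p 0) * Real.exp (c * t) := by
  have hl := hB.pos
  have hP0 : 0 ≤ P := (norm_nonneg _).trans (h.norm_le _ _ (hp 0 le_rfl))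
  have hK := hB.nonneg
  have hκ := hG.nonneg
  have hC := h.nonneg
  set c₀ : ℝ := κ * (K * P) + 4 * C + 2 * κ * (K * P) with hc₀
  set c : ℝ := c₀ * K ^ 2 / l with hc
  have hcont : ContinuousOn γ (Ici 0) := fun s hs =>
    ((hγ.lipschitzOnWith (b := s + 1) le_rfl).continuousOn s
      ⟨hs, by linarith⟩).mono_of_mem_nhdsWithin (by
        filter_upwards [self_mem_nhdsWithin, mem_nhdsWithin_of_mem_nhds
          (Iio_mem_nhds (by linarith : s < s + 1))] with t h1 h2
        exact ⟨h1, le_of_lt h2⟩)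
  have hgron : ∀ τ, 0 < τ → ∀ t, 0 ≤ t →
      inner ℝ (G (γ t) (γ (t + τ) - γ t)) (γ (t + τ) - γ t) ≤
        inner ℝ (G (γ 0) (γ τ - γ 0)) (γ τ - γ 0) * Real.exp (c * t) := by
    intro τ hτ T hT
    set e : ℝ → RSpace n := fun t => γ (t + τ) - γ t with he
    set f : ℝ → ℝ := fun t => inner ℝ (G (γ t) (e t)) (e t) with hf
    set w : ℝ → RSpace n := fun t => B (γ t) (p t) with hw
    set f' : ℝ → ℝ := fun t => inner ℝ (G (γ t) (e t)) (w (t + τ) - w t) +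
      inner ℝ (fderiv ℝ G (γ t) (w t) (e t) + G (γ t) (w (t + τ) - w t)) (e t) with hf'
    have hd : ∀ t, 0 ≤ t → HasDerivWithinAt f (f' t) (Ici t) t := by
      intro t ht
      have h1 : HasDerivWithinAt (fun t => γ (t + τ)) (w (t + τ)) (Ici t) t := by
        have h2 : HasDerivWithinAt (fun t : ℝ => t + τ) 1 (Ici t) t :=
          ((hasDerivAt_id t).add_const τ).hasDerivWithinAt
        have h3 := (hderiv (t + τ) (by linarith)).scomp t h2
          (fun r (hr : t ≤ r) => (by simpa using hr : t + τ ≤ r + τ))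
        rw [one_smul] at h3
        exact h3
      have he' : HasDerivWithinAt e (w (t + τ) - w t) (Ici t) t := h1.sub (hderiv t ht)
      have hG' : HasDerivWithinAt (fun t => G (γ t)) (fderiv ℝ G (γ t) (w t)) (Ici t) t :=
        (hG.differentiable (γ t)).hasFDerivAt.comp_hasDerivWithinAt t (hderiv t ht)
      exact (hG'.clm_apply he').inner ℝ he'
    have hbound : ∀ t, 0 ≤ t → f' t ≤ c * f t := by
      intro t ht
      have h1 := hG.inner_apply_sub_le hB h (hp (t + τ) (by linarith)) (x := γ t) (p := p t) (e t)
      have h2 := h.inner_sub_le (hp t ht) (hp (t + τ) (by linarith))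
      have e1 : inner ℝ (G (γ t) (w (t + τ) - w t)) (e t) =
          inner ℝ (G (γ t) (e t)) (w (t + τ) - w t) := by rw [hG.symm, real_inner_comm]
      have h3 : inner ℝ (fderiv ℝ G (γ t) (w t) (e t)) (e t) ≤ κ * (K * P) * ‖e t‖ ^ 2 := by
        refine (le_abs_self _).trans ((abs_inner_apply_le _ _ _).trans ?_)
        have h4 : ‖fderiv ℝ G (γ t) (w t)‖ ≤ κ * (K * P) :=
          ((fderiv ℝ G (γ t)).le_opNorm _).trans (mul_le_mul (hG.fderiv_le _)
            (hB.norm_apply_le h (hp t ht) _) (norm_nonneg _) hκ)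
        rw [mul_assoc, ← sq]
        exact mul_le_mul_of_nonneg_right h4 (sq_nonneg _)
      have h5 := hG.norm_sq_le hB (γ t) (e t)
      have h6 : f' t ≤ c₀ * ‖e t‖ ^ 2 := by
        simp only [hf', inner_add_left, e1, hc₀]
        have h7 : inner ℝ (e t) (p (t + τ) - p t) ≤ 2 * C * ‖e t‖ ^ 2 := h2
        have h8 : inner ℝ (G (γ t) (e t)) (w (t + τ) - w t) ≤
          inner ℝ (e t) (p (t + τ) - p t) + κ * ‖e t‖ * (K * ‖e t‖ * P) := h1
        linarith
      refine h6.trans ?_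
      have h9 : c * f t = c₀ * (K ^ 2 * f t / l) := by rw [hc]; ring
      rw [h9]
      refine mul_le_mul_of_nonneg_left ?_ (by positivity)
      rw [le_div_iff₀ hl]
      linarith
    have hfc : ContinuousOn f (Icc 0 T) := by
      have c1 : ContinuousOn γ (Icc 0 T) := hcont.mono Icc_subset_Ici_self
      have c2 : ContinuousOn (fun t => γ (t + τ)) (Icc 0 T) :=
        hcont.comp (by fun_prop) fun t ht => (by
          have := ht.1
          simp only [mem_Ici]
          linarith)
      have c3 : ContinuousOn e (Icc 0 T) := c2.sub c1
      have c4 : ContinuousOn (fun t => G (γ t)) (Icc 0 T) :=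
        hG.differentiable.continuous.comp_continuousOn c1
      exact (c4.clm_apply c3).inner c3
    have := le_gronwallBound_of_liminf_deriv_right_le (δ := f 0) (K := c) (ε := 0) hfc
      (fun t ht r hr => (hd t ht.1).liminf_right_slope_le hr) le_rfl
      (fun t ht => by rw [add_zero]; exact hbound t ht.1) T ⟨hT, le_rfl⟩
    rw [gronwallBound_ε0, sub_zero] at this
    simpa [hf, he] using this
  refine ⟨c, fun t ht => ?_⟩
  have hq : ∀ t, 0 ≤ t → Tendsto (fun τ : ℝ => τ⁻¹ • (γ (t + τ) - γ t)) (𝓝[>] 0)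
      (𝓝 (B (γ t) (p t))) := by
    intro t ht
    have h1 := hasDerivWithinAt_iff_tendsto_slope' (lt_irrefl t : t ∉ Ioi t) |>.1
      ((hderiv t ht).mono Ioi_subset_Ici_self)
    have h2 : Tendsto (fun τ : ℝ => t + τ) (𝓝[>] 0) (𝓝[>] t) := by
      refine tendsto_nhdsWithin_iff.2 ⟨?_, ?_⟩
      · have : Continuous fun τ : ℝ => t + τ := by fun_prop
        simpa using (this.tendsto 0).mono_left nhdsWithin_le_nhds
      · filter_upwards [self_mem_nhdsWithin] with τ hτ
        simpa using hτ
    refine (h1.comp h2).congr fun τ => ?_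
    simp [slope_def_module]
  have hlim : ∀ t, 0 ≤ t → Tendsto (fun τ : ℝ => inner ℝ (G (γ t) (τ⁻¹ • (γ (t + τ) - γ t)))
      (τ⁻¹ • (γ (t + τ) - γ t))) (𝓝[>] 0) (𝓝 (inner ℝ (B (γ t) (p t)) (p t))) := by
    intro t ht
    have := (((G (γ t)).continuous.tendsto _).comp (hq t ht)).inner (𝕜 := ℝ) (hq t ht)
    rw [hG.left_inv, real_inner_comm] at this
    exact this
  refine le_of_tendsto_of_tendsto (hlim t ht) ((hlim 0 le_rfl).mul_const (Real.exp (c * t))) ?_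
  filter_upwards [self_mem_nhdsWithin] with τ hτ
  have h1 := hgron τ hτ t ht
  simp only [map_smul, inner_smul_left, inner_smul_right, conj_trivial, zero_add]
  have h2 : 0 ≤ τ⁻¹ * τ⁻¹ := mul_self_nonneg _
  have := mul_le_mul_of_nonneg_left h1 h2
  linarith

end RightDerivative

/-! ### Level sets and critical points -/

section LevelSet

variable {n : ℕ} {v : RSpace n → ℝ} {x : RSpace n}

/-- A function that oscillates little below its value at the centre of a ball has a small
subgradient inside the ball. -/
theorem exists_small_subgradient (hv : Continuous v) {z : RSpace n} {r b m : ℝ} (hr : 0 < r)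
    (hb : 0 < b) (hm : ∀ y, ‖y - z‖ ≤ r → m ≤ v y) (hz : v z ≤ m + b) :
    ∃ y p, ‖y - z‖ ≤ r ∧ p ∈ subdiff v y ∧ ‖p‖ ≤ 4 * b / r := by
  set k := 2 * b / r ^ 2 with hk
  have hk0 : 0 < k := by positivity
  obtain ⟨y, hy, hmin⟩ := (isCompact_closedBall z r).exists_isMinOn
    ⟨z, Metric.mem_closedBall_self hr.le⟩
    (f := fun y => v y + k * ‖y - z‖ ^ 2) (by fun_prop)
  have hyr : ‖y - z‖ ≤ r := by simpa [dist_eq_norm] using hy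
  have hlt : ‖y - z‖ < r := by
    refine lt_of_le_of_ne hyr fun heq => ?_
    have h1 : v y + k * ‖y - z‖ ^ 2 ≤ v z + k * ‖z - z‖ ^ 2 :=
      hmin (Metric.mem_closedBall_self hr.le)
    rw [heq, sub_self, norm_zero] at h1
    have h2 := hm y hyr
    have h3 : k * r ^ 2 = 2 * b := by rw [hk]; field_simp
    rw [h3] at h1
    linarith
  refine ⟨y, (-k) • ((2 * 1 : ℝ) • (y - z)), hyr, ?_, ?_⟩
  · have hd := (hasFDerivAt_norm_add_smul_sq (y - z) 1).const_mul (-k)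
    rw [← map_smul] at hd
    refine mem_subdiff_of_le hd ?_
    have ht : ∀ᶠ e : RSpace n in 𝓝 0, ‖y - z + e‖ < r := by
      have hc : Continuous fun e : RSpace n => ‖y - z + e‖ := by fun_prop
      exact (hc.tendsto 0).eventually (gt_mem_nhds (by simpa using hlt))
    filter_upwards [ht] with e he
    have e1 : y + e - z = y - z + (1 : ℝ) • e := by module
    have h1 : v y + k * ‖y - z‖ ^ 2 ≤ v (y + e) + k * ‖y + e - z‖ ^ 2 := hmin (by
      rw [mem_closedBall_iff_norm, e1, one_smul]
      exact he.le)
    rw [e1] at h1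
    simp only [smul_zero, add_zero]
    linarith
  · rw [norm_smul, norm_smul, norm_neg, Real.norm_eq_abs, Real.norm_eq_abs, abs_of_pos hk0]
    norm_num
    calc k * (2 * ‖y - z‖) ≤ k * (2 * r) := by gcongr
      _ = 4 * b / r := by rw [hk]; field_simp; ring

/-- If the level set of `v` through `x` is a Lipschitz graph near `x` and `x` is not a local
maximum point, then `v` exceeds `v x` on one side of the graph, hence on a truncated open cone
with vertex `x`. -/
theorem exists_cone_of_lipschitzHypersurface (hv : Continuous v) (hmax : ¬ IsLocalMax v x)
    (hS : IsLipschitzHypersurfaceNear (levelSet v x) x) :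
    ∃ (θ : RSpace n) (δ h₀ : ℝ), 0 < δ ∧ 0 < h₀ ∧
      ∀ h, 0 < h → h < h₀ → ∀ y, ‖y - (x + h • θ)‖ ≤ δ * h → v x ≤ v y := by
  obtain ⟨hx, T₀, f, ⟨L, hf⟩, U, hU, hgraph⟩ := hS
  set T : RSpace n ≃L[ℝ] RSpace (n - 1) × ℝ := T₀.toContinuousLinearEquiv with hT
  have hgraph : ∀ y ∈ U, v y = v x ↔ (T y).2 = f (T y).1 := hgraph
  clear_value T
  set z₀ := (T x).1 with hz₀
  have ht₀ : (T x).2 = f z₀ := (hgraph x (mem_of_mem_nhds hU)).1 rfl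
  -- `Φ` straightens the graph: it is a homeomorphism taking the level set to `{s = 0}`.
  set Φ : RSpace (n - 1) × ℝ → RSpace n := fun a => T.symm (a.1, f a.1 + a.2) with hΦ
  have hΦc : Continuous Φ :=
    T.symm.continuous.comp (by have := hf.continuous; fun_prop)
  set Ψ : RSpace n → RSpace (n - 1) × ℝ := fun y => ((T y).1, (T y).2 - f (T y).1) with hΨ
  have hΨc : Continuous Ψ := by
    have h1 := hf.continuous
    have h2 := T.continuous
    fun_prop
  have hΦΨ : ∀ y, Φ (Ψ y) = y := fun y => by simp [hΦ, hΨ]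
  have hTΦ : ∀ a, T (Φ a) = (a.1, f a.1 + a.2) := fun a => by simp [hΦ]
  have hΨx : Ψ x = (z₀, 0) := by simp [hΨ, ht₀, ← hz₀]
  have hΦ0 : Φ (z₀, 0) = x := by rw [← hΨx, hΦΨ]
  obtain ⟨r, hr, hball⟩ : ∃ r > 0, ∀ a ∈ Metric.ball (z₀, (0 : ℝ)) r, Φ a ∈ U :=
    Metric.eventually_nhds_iff_ball.1 ((hΦc.tendsto (z₀, 0)).eventually (by rwa [hΦ0]))
  have hne : ∀ a ∈ Metric.ball (z₀, (0 : ℝ)) r, (v (Φ a) = v x ↔ a.2 = 0) := by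
    intro a ha
    rw [hgraph _ (hball a ha), hTΦ]
    simp
  -- A nearby point above the level `v x`, on the side `σ`.
  have hfreq : ∃ᶠ y in 𝓝 x, v x < v y := by
    simpa [IsLocalMax, IsMaxFilter, not_eventually] using hmax
  have hnear : ∀ᶠ y in 𝓝 x, Ψ y ∈ Metric.ball (z₀, (0 : ℝ)) r :=
    (hΨc.tendsto x).eventually (by rw [hΨx]; exact Metric.ball_mem_nhds _ hr)
  obtain ⟨y₁, hy₁, hy₁r⟩ := (hfreq.and_eventually hnear).exists
  set a₁ := Ψ y₁ with ha₁
  have hva₁ : v x < v (Φ a₁) := by rw [ha₁, hΦΨ]; exact hy₁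
  have hs₁ : a₁.2 ≠ 0 := fun h0 => hva₁.ne' ((hne a₁ hy₁r).2 h0)
  obtain ⟨σ, hσ, hσ₁⟩ : ∃ σ : ℝ, |σ| = 1 ∧ 0 < σ * a₁.2 := by
    rcases lt_or_gt_of_ne hs₁ with h | h
    · exact ⟨-1, by simp, by linarith⟩
    · exact ⟨1, by simp, by linarith⟩
  have hσσ : σ * σ = 1 := by rw [← abs_mul_abs_self, hσ, one_mul]
  set D : Set (RSpace (n - 1) × ℝ) := Metric.ball (z₀, (0 : ℝ)) r ∩ {a | 0 < σ * a.2} with hD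
  have hDconn : IsPreconnected D := by
    refine Convex.isPreconnected ((convex_ball _ _).inter ?_)
    intro a ha b hb s t hs ht hst
    simp only [mem_ofPred_eq, Prod.snd_add, Prod.smul_snd, smul_eq_mul] at ha hb ⊢
    have e1 : σ * (s * a.2 + t * b.2) = s * (σ * a.2) + t * (σ * b.2) := by ring
    rw [e1]
    rcases hs.lt_or_eq with h | h
    · have := mul_pos h ha
      have := mul_nonneg ht hb.le
      linarith
    · have ht1 : t = 1 := by linarith
      rw [← h, ht1]
      linarith
  have hside : ∀ a ∈ D, v x < v (Φ a) := by
    intro a ha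
    by_contra hle
    push Not at hle
    obtain ⟨b, hb, hvb⟩ := hDconn.intermediate_value ha ⟨hy₁r, hσ₁⟩
      (hv.comp hΦc).continuousOn ⟨hle, hva₁.le⟩
    have h0 := (hne b hb.1).1 hvb
    have h1 : 0 < σ * b.2 := hb.2
    rw [h0, mul_zero] at h1
    exact lt_irrefl _ h1
  set τ : ℝ := 1 / (2 * (L + 1)) with hτ
  have hL0 : (0 : ℝ) ≤ L := L.2
  have hτ0 : 0 < τ := by positivity
  have hτL : (1 + L) * τ = 1 / 2 := by rw [hτ]; field_simp; ring
  have hτ1 : τ ≤ 1 / 2 := by nlinarith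
  set N := ‖(T : RSpace n →L[ℝ] RSpace (n - 1) × ℝ)‖ with hN
  have hN0 : 0 ≤ N := norm_nonneg _
  refine ⟨T.symm (0, σ), τ / (N + 1), r / 2, by positivity, by positivity, ?_⟩
  intro h hh hhr y hy
  set ξ := y - (x + h • T.symm (0, σ)) with hξ
  have hTξ : ‖T ξ‖ ≤ τ * h := by
    refine ((T : RSpace n →L[ℝ] RSpace (n - 1) × ℝ).le_opNorm ξ).trans ?_
    calc N * ‖ξ‖ ≤ N * (τ / (N + 1) * h) := mul_le_mul_of_nonneg_left hy hN0
      _ = (N / (N + 1)) * (τ * h) := by ring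
      _ ≤ τ * h := mul_le_of_le_one_left (by positivity)
          ((div_le_one (by positivity)).2 (by linarith))
  have hTy : T y = T x + h • ((0 : RSpace (n - 1)), σ) + T ξ := by
    have : y = x + h • T.symm (0, σ) + ξ := by rw [hξ]; abel
    conv_lhs => rw [this]
    rw [map_add, map_add, map_smul, T.apply_symm_apply]
  have h1 : ‖(T ξ).1‖ ≤ τ * h := (norm_fst_le _).trans hTξ
  have h2 : |(T ξ).2| ≤ τ * h := (norm_snd_le _).trans hTξ
  have hy1 : (T y).1 = z₀ + (T ξ).1 := by rw [hTy]; simp [hz₀]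
  have hy2 : (T y).2 = f z₀ + h * σ + (T ξ).2 := by rw [hTy]; simp [ht₀]
  have h3 : |f z₀ - f (T y).1| ≤ L * (τ * h) := by
    have := hf.dist_le_mul z₀ (T y).1
    rw [Real.dist_eq, dist_eq_norm, hy1, sub_add_cancel_left, norm_neg] at this
    rw [hy1]
    exact this.trans (mul_le_mul_of_nonneg_left h1 hL0)
  have hs : |(Ψ y).2 - h * σ| ≤ h / 2 := by
    have e1 : (Ψ y).2 - h * σ = (f z₀ - f (T y).1) + (T ξ).2 := by
      simp only [hΨ, hy2]; ring
    rw [e1]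
    refine (abs_add_le _ _).trans ?_
    have : L * (τ * h) + τ * h = ((1 + L) * τ) * h := by ring
    rw [hτL] at this
    linarith
  have hτh : τ * h ≤ h / 2 := by nlinarith
  have hmemD : Ψ y ∈ D := by
    refine ⟨?_, ?_⟩
    · rw [mem_ball_iff_norm, Prod.norm_def, max_lt_iff]
      constructor
      · have : (Ψ y - (z₀, (0 : ℝ))).1 = (T ξ).1 := by simp [hΨ, hy1]
        rw [this]
        linarith
      · have : (Ψ y - (z₀, (0 : ℝ))).2 = ((Ψ y).2 - h * σ) + h * σ := by simp
        rw [this, Real.norm_eq_abs]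
        refine (abs_add_le _ _).trans_lt ?_
        rw [abs_mul, hσ, abs_of_pos hh]
        linarith
    · change 0 < σ * (Ψ y).2
      have e1 : σ * (Ψ y).2 = h + σ * ((Ψ y).2 - h * σ) := by linear_combination h * hσσ
      have e2 : |σ * ((Ψ y).2 - h * σ)| ≤ h / 2 := by rw [abs_mul, hσ, one_mul]; exact hs
      rw [e1]
      linarith [(abs_le.1 e2).1]
  have := hside _ hmemD
  rw [hΦΨ] at this
  exact this.le

/-- Under a lower bound for the subgradients near `x`, the supergradients of a semiconcave function
at `x` do not vanish: if `0 ∈ D⁺v(x)`, then `v x ≤ v ≤ v x + O(h²)` on balls of radius of order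
`h` inside the cone where `v` exceeds `v x`, which yields subgradients of size `O(h)`. -/
theorem zero_notMem_superdiff {P C : ℝ} (h : IsLipschitzSemiconcave v P C) {ρ : ℝ} (hρ : 0 < ρ)
    (hsub : ∀ᶠ y in 𝓝 x, ∀ p ∈ subdiff v y, ρ ≤ ‖p‖) (hmax : ¬ IsLocalMax v x)
    (hS : IsLipschitzHypersurfaceNear (levelSet v x) x) : (0 : RSpace n) ∉ superdiff v x := by
  intro h0
  obtain ⟨θ, δ, h₀, hδ, hh₀, hcone⟩ :=
    exists_cone_of_lipschitzHypersurface h.continuous hmax hS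
  obtain ⟨d, hd, hball⟩ := Metric.eventually_nhds_iff_ball.1 hsub
  have hC := h.nonneg
  set c := C * ‖θ‖ ^ 2 + 1 with hc
  have hc0 : 0 < c := by positivity
  obtain ⟨t, ht0, ht⟩ : ∃ t : ℝ, 0 < t ∧ (t < h₀ ∧ t * (‖θ‖ + δ) < d ∧ 4 * c / δ * t < ρ) := by
    have e1 : ∀ᶠ t : ℝ in 𝓝[>] 0, t < h₀ := nhdsWithin_le_nhds (gt_mem_nhds hh₀)
    have e2 : ∀ᶠ t : ℝ in 𝓝[>] 0, t * (‖θ‖ + δ) < d := by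
      have hc : Continuous fun t : ℝ => t * (‖θ‖ + δ) := by fun_prop
      exact nhdsWithin_le_nhds ((hc.tendsto 0).eventually (gt_mem_nhds (by simpa using hd)))
    have e3 : ∀ᶠ t : ℝ in 𝓝[>] 0, 4 * c / δ * t < ρ := by
      have hc : Continuous fun t : ℝ => 4 * c / δ * t := by fun_prop
      exact nhdsWithin_le_nhds ((hc.tendsto 0).eventually (gt_mem_nhds (by simpa using hρ)))
    obtain ⟨t, ht⟩ := ((eventually_mem_nhdsWithin.and (e1.and (e2.and e3))).exists)
    exact ⟨t, ht⟩
  obtain ⟨ht1, ht2, ht3⟩ := ht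
  have hval : v (x + t • θ) ≤ v x + c * t ^ 2 := by
    have h1 := h.le_of_mem_superdiff h0 (x + t • θ)
    rw [inner_zero_left, add_sub_cancel_left, norm_smul, mul_pow, Real.norm_eq_abs, sq_abs] at h1
    rw [hc]
    nlinarith [sq_nonneg t]
  obtain ⟨y, p, hy, hp, hpn⟩ := exists_small_subgradient h.continuous (mul_pos hδ ht0)
    (by positivity : 0 < c * t ^ 2) (hcone t ht0 ht1) hval
  have hyd : y ∈ Metric.ball x d := by
    rw [mem_ball_iff_norm]
    have e1 : y - x = (y - (x + t • θ)) + t • θ := by abel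
    rw [e1]
    refine (norm_add_le _ _).trans_lt ?_
    rw [norm_smul, Real.norm_eq_abs, abs_of_pos ht0]
    linarith
  have h1 := hball y hyd p hp
  have e2 : 4 * (c * t ^ 2) / (δ * t) = 4 * c / δ * t := by field_simp
  rw [e2] at hpn
  linarith

end LevelSet

/-! ### The mechanical Hamiltonian -/

section Mechanical

variable {n : ℕ} {A : RSpace n → Matrix (Fin n) (Fin n) ℝ} {V : RSpace n → ℝ}

/-- The matrix field `A` as a field of bounded operators on `ℝⁿ`. -/
noncomputable def cometric (A : RSpace n → Matrix (Fin n) (Fin n) ℝ) (x : RSpace n) :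
    RSpace n →L[ℝ] RSpace n :=
  Matrix.toEuclideanCLM (n := Fin n) (𝕜 := ℝ) (A x)

theorem mechHamiltonian_eq (A : RSpace n → Matrix (Fin n) (Fin n) ℝ) (V : RSpace n → ℝ)
    (x p : RSpace n) : mechHamiltonian A V x p = 1 / 2 * inner ℝ (cometric A x p) p + V x :=
  rfl

theorem IsPeriodicMetric.contDiff_cometric (hA : IsPeriodicMetric A) :
    ContDiff ℝ ∞ (cometric A) := by
  have h : cometric A = fun x => ∑ i, ∑ j, A x i j •
      Matrix.toEuclideanCLM (n := Fin n) (𝕜 := ℝ) (Matrix.single i j 1) := by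
    funext x
    simp only [cometric]
    conv_lhs => rw [Matrix.matrix_eq_sum_single (A x)]
    simp only [map_sum, ← map_smul, Matrix.smul_single, smul_eq_mul, mul_one]
  rw [h]
  exact ContDiff.sum fun i _ => ContDiff.sum fun j _ => (hA.smooth i j).smul contDiff_const

theorem IsPeriodicMetric.isZPeriodic_cometric (hA : IsPeriodicMetric A) :
    IsZPeriodic (cometric A) := fun x k => by
  simp only [cometric, hA.periodic x k]

theorem IsPeriodicMetric.inner_cometric (hA : IsPeriodicMetric A) (x p q : RSpace n) :
    inner ℝ (cometric A x p) q = inner ℝ p (cometric A x q) :=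
  Matrix.isSymmetric_toEuclideanLin_iff.2 (hA.posDef x).isHermitian p q

theorem IsPeriodicMetric.inner_cometric_pos (hA : IsPeriodicMetric A) (x : RSpace n)
    {p : RSpace n} (hp : p ≠ 0) : 0 < inner ℝ (cometric A x p) p := by
  rw [real_inner_comm, cometric, Matrix.inner_toEuclideanCLM]
  exact (hA.posDef x).dotProduct_mulVec_pos (x := p.ofLp) (by simpa using hp)

theorem IsPeriodicMetric.exists_elliptic (hA : IsPeriodicMetric A) :
    ∃ l : ℝ, 0 < l ∧ ∀ x p, l * ‖p‖ ^ 2 ≤ inner ℝ (cometric A x p) p := by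
  have hc := hA.contDiff_cometric.continuous
  obtain ⟨l, hl, hle⟩ := ((isCompact_closedBall (0 : RSpace n) (√n)).prod
    (isCompact_sphere (0 : RSpace n) 1)).exists_forall_le'
    (f := fun z : RSpace n × RSpace n => inner ℝ (cometric A z.1 z.2) z.2) (a := 0)
    (by
      have h1 : Continuous fun z : RSpace n × RSpace n => cometric A z.1 z.2 :=
        (hc.comp continuous_fst).clm_apply continuous_snd
      exact (h1.inner continuous_snd).continuousOn)
    (fun z hz => hA.inner_cometric_pos z.1 (by
      have : ‖z.2‖ = 1 := by simpa using hz.2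
      intro h0
      rw [h0, norm_zero] at this
      exact zero_ne_one this))
  refine ⟨l, hl, fun x p => ?_⟩
  rcases eq_or_ne p 0 with rfl | hp
  · simp
  obtain ⟨k, hk⟩ := exists_int_translate_norm_le x
  have hp0 : ‖p‖ ≠ 0 := norm_ne_zero_iff.2 hp
  have h1 := hle (x + WithLp.toLp 2 (fun i => (k i : ℝ)), ‖p‖⁻¹ • p)
    ⟨by simpa using hk, by simp [norm_smul, hp0]⟩
  simp only [hA.isZPeriodic_cometric x k, map_smul, inner_smul_left, inner_smul_right,
    conj_trivial] at h1
  have h2 := mul_le_mul_of_nonneg_right h1 (sq_nonneg ‖p‖)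
  have e : ‖p‖⁻¹ * (‖p‖⁻¹ * inner ℝ (cometric A x p) p) * ‖p‖ ^ 2 =
      inner ℝ (cometric A x p) p := by field_simp
  rwa [e] at h2

theorem IsPeriodicMetric.exists_isUniformCometric (hA : IsPeriodicMetric A)
    (hV : IsPeriodicPotential V) :
    ∃ l K, IsUniformCometric (cometric A) l K ∧
      ∀ x y z, ‖V x + V y - (2 : ℝ) • V z‖ ≤ K * (‖x + y - (2 : ℝ) • z‖ + ‖x - y‖ ^ 2) := by
  have hB := hA.contDiff_cometric
  have hper := hA.isZPeriodic_cometric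
  obtain ⟨l, hl, hell⟩ := hA.exists_elliptic
  obtain ⟨K₁, hK₁, h1⟩ := hper.exists_norm_le hB.continuous
  obtain ⟨K₂, hK₂, h2⟩ := hper.exists_lipschitz (contDiff_infty.1 hB 1)
  obtain ⟨K₃, hK₃, h3⟩ := hper.exists_second_difference_le (contDiff_infty.1 hB 2)
  obtain ⟨K₄, hK₄, h4⟩ :=
    hV.periodic.exists_second_difference_le (contDiff_infty.1 hV.smooth 2)
  refine ⟨l, K₁ + K₂ + K₃ + K₄, ⟨hA.inner_cometric, hl, by positivity, hell,
    fun x => (h1 x).trans (by linarith), fun x y => (h2 x y).trans ?_,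
    fun x y z => (h3 x y z).trans ?_⟩, fun x y z => (h4 x y z).trans ?_⟩ <;>
  exact mul_le_mul_of_nonneg_right (by linarith) (by positivity)

theorem IsPeriodicMetric.exists_isDualMetric (hA : IsPeriodicMetric A) :
    ∃ G κ, IsDualMetric (cometric A) G κ := by
  have hunit : ∀ x, IsUnit (cometric A x) := fun x =>
    (hA.posDef x).isUnit.map (Matrix.toEuclideanCLM (n := Fin n) (𝕜 := ℝ))
  set G : RSpace n → RSpace n →L[ℝ] RSpace n := fun x => Ring.inverse (cometric A x) with hG
  have hGper : IsZPeriodic G := fun x k => by simp only [hG, hA.isZPeriodic_cometric x k]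
  have hGs : ContDiff ℝ 1 G := by
    rw [contDiff_iff_contDiffAt]
    intro x
    have h1 := contDiffAt_ringInverse ℝ (n := 1) (hunit x).unit
    rw [IsUnit.unit_spec] at h1
    exact h1.comp x (contDiff_infty.1 hA.contDiff_cometric 1).contDiffAt
  have hl : ∀ x p, G x (cometric A x p) = p := fun x p => by
    have := Ring.inverse_mul_cancel _ (hunit x)
    exact congrArg (fun T : RSpace n →L[ℝ] RSpace n => T p) this
  have hr : ∀ x e, cometric A x (G x e) = e := fun x p => by
    have := Ring.mul_inverse_cancel _ (hunit x)
    exact congrArg (fun T : RSpace n →L[ℝ] RSpace n => T p) this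
  obtain ⟨κ₁, h1, hκ₁⟩ := hGper.exists_norm_le hGs.continuous
  obtain ⟨κ₂, h2, hκ₂⟩ := hGper.exists_fderiv_le hGs
  refine ⟨G, κ₁ + κ₂, fun x p q => ?_, hl, hr, by positivity,
    fun x => (hκ₁ x).trans (by linarith), hGs.differentiable one_ne_zero,
    fun x => (hκ₂ x).trans (by linarith)⟩
  have := hA.inner_cometric x (G x p) (G x q)
  rw [hr, hr] at this
  exact this.symm

theorem IsPeriodicMetric.gradient_mechHamiltonian (hA : IsPeriodicMetric A) (x p : RSpace n) :
    gradient (mechHamiltonian A V x) p = cometric A x p := by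
  refine HasGradientAt.gradient ?_
  rw [hasGradientAt_iff_hasFDerivAt]
  have h1 : HasFDerivAt (fun p => inner ℝ (cometric A x p) p) _ p :=
    (cometric A x).hasFDerivAt.inner ℝ (hasFDerivAt_id p)
  refine ((h1.const_mul (1 / 2)).add_const (V x)).congr_fderiv ?_
  ext w
  have h2 : inner ℝ (cometric A x w) p = inner ℝ (cometric A x p) w := by
    rw [hA.inner_cometric, real_inner_comm]
  simp [h2]
  ring

theorem IsPeriodicMetric.closure_convexHull_eq (hA : IsPeriodicMetric A) {x : RSpace n}
    {D : Set (RSpace n)} (hD : Convex ℝ D) (hc : IsCompact D) :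
    closure (convexHull ℝ ((fun p => gradient (mechHamiltonian A V x) p) '' D)) =
      cometric A x '' D := by
  have h1 : (fun p => gradient (mechHamiltonian A V x) p) = cometric A x :=
    funext (hA.gradient_mechHamiltonian x)
  rw [h1]
  have h2 : Convex ℝ (cometric A x '' D) :=
    hD.is_linear_image (cometric A x).isBoundedLinearMap.toIsLinearMap
  rw [h2.convexHull_eq, (hc.image (cometric A x).continuous).isClosed.closure_eq]

theorem IsWeakKAMSolution.le_of_mem_superdiff {c : RSpace n} {a : ℝ} {u : RSpace n → ℝ}
    (hu : IsWeakKAMSolution (mechHamiltonian A V) c a u) {x p : RSpace n}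
    (hp : p ∈ superdiff (liftedSolution c u) x) :
    1 / 2 * inner ℝ (cometric A x p) p + V x ≤ a := by
  have := hu.viscosity.subsolution x _ (mem_superdiff_liftedSolution.1 hp)
  rwa [add_sub_cancel, mechHamiltonian_eq] at this

theorem IsWeakKAMSolution.le_of_mem_subdiff {c : RSpace n} {a : ℝ} {u : RSpace n → ℝ}
    (hu : IsWeakKAMSolution (mechHamiltonian A V) c a u) {x p : RSpace n}
    (hp : p ∈ subdiff (liftedSolution c u) x) :
    a ≤ 1 / 2 * inner ℝ (cometric A x p) p + V x := by
  have := hu.viscosity.supersolution x _ (mem_subdiff_liftedSolution.1 hp)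
  rwa [add_sub_cancel, mechHamiltonian_eq] at this

theorem IsWeakKAMSolution.exists_isLipschitzSemiconcave (hA : IsPeriodicMetric A)
    (hV : IsPeriodicPotential V) {c : RSpace n} {a : ℝ} {u : RSpace n → ℝ}
    (hu : IsWeakKAMSolution (mechHamiltonian A V) c a u) :
    ∃ P C, IsLipschitzSemiconcave (liftedSolution c u) P C := by
  obtain ⟨l, K, hB, hV2⟩ := hA.exists_isUniformCometric hV
  obtain ⟨b, hb0, hb⟩ := hV.periodic.exists_norm_le hV.smooth.continuous
  have hl := hB.pos
  have hcont := hu.viscosity.continuous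
  set R := √(2 * (|a| + b) / l) with hR
  set P := max R ‖c‖ + 1 with hP
  have hPR : R < P := by linarith [le_max_left R ‖c‖]
  have hPc : ‖c‖ < P := by linarith [le_max_right R ‖c‖]
  have hlt : ∀ x, ∀ p ∈ superdiff (liftedSolution c u) x, ‖p‖ < P := by
    intro x p hp
    refine lt_of_le_of_lt (Real.le_sqrt_of_sq_le ?_) hPR
    have h1 := hu.le_of_mem_superdiff hp
    have h2 := hB.elliptic x p
    have h3 := (abs_le.1 (hb x)).1
    rw [le_div_iff₀ hl]
    linarith [le_abs_self a]
  have hP0 : 0 ≤ P := (norm_nonneg c).trans hPc.le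
  obtain ⟨C, hC0, hC⟩ := exists_semiconcave_const hu.periodic hcont hB hV2 hP0
    (fun x p hp => (hlt x p hp).le) (fun x p hp => hu.le_of_mem_superdiff hp)
    (fun x p hp => hu.le_of_mem_subdiff hp)
  refine ⟨P, C / 2, by positivity, liftedSolution_lipschitz hu.periodic hcont hPc hlt,
    fun x p hp => (hlt x p hp).le, fun x e => (hC x e).trans (le_of_eq (by ring))⟩

end Mechanical

/-! ### Monotonicity along characteristics and propagation of singularities -/

section Propagation

variable {n : ℕ} {v : RSpace n → ℝ} {P C l K : ℝ} {B : RSpace n → RSpace n →L[ℝ] RSpace n}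

/-- Chain rule: where both derivatives exist, every supergradient computes the derivative of `v`
along a curve, since the upper paraboloid touches at that point. -/
theorem IsLipschitzSemiconcave.hasDerivAt_comp_eq (h : IsLipschitzSemiconcave v P C)
    {γ : ℝ → RSpace n} {s d : ℝ} {w p : RSpace n} (hγ : HasDerivAt γ w s)
    (hd : HasDerivAt (fun t => v (γ t)) d s) (hp : p ∈ superdiff v (γ s)) :
    d = inner ℝ p w := by
  have h1 := hγ.sub_const (γ s)
  have h2 := ((((hasDerivAt_const s p).inner ℝ h1).add
    ((h1.inner ℝ h1).const_mul C)).const_add (v (γ s))).sub hd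
  have hmin : IsLocalMin ((fun t => v (γ s) + (inner ℝ p (γ t - γ s) +
      C * inner ℝ (γ t - γ s) (γ t - γ s))) - fun t => v (γ t)) s := by
    refine Eventually.of_forall fun t => ?_
    have := h.le_of_mem_superdiff hp (γ t)
    simp only [Pi.sub_apply, sub_self, inner_zero_right, real_inner_self_eq_norm_sq]
    rw [norm_zero]
    linarith
  have h3 := hmin.hasDerivAt_eq_zero h2
  simp at h3
  linarith

/-- Along a solution of `γ' ∈ B(γ) D⁺v(γ)` the derivative of `v ∘ γ` is `⟨B p, p⟩ ≥ 0`, so that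
`v ∘ γ` can fail to increase only where `γ` rests. -/
theorem IsLipschitzSemiconcave.lt_along_characteristic (h : IsLipschitzSemiconcave v P C)
    (hB : IsUniformCometric B l K) {γ : ℝ → RSpace n} {L : NNReal} {τ : ℝ}
    (hγ : LipschitzOnWith L γ (Icc 0 τ))
    (hinc : ∀ᵐ s ∂(volume.restrict (Icc 0 τ)),
      ∃ p ∈ superdiff v (γ s), HasDerivAt γ (B (γ s) p) s)
    (hne : ∀ s ∈ Ico 0 τ, ¬ HasDerivWithinAt γ 0 (Ici s) s) {s₁ s₂ : ℝ} (h₁ : 0 ≤ s₁)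
    (h₁₂ : s₁ < s₂) (h₂ : s₂ ≤ τ) : v (γ s₁) < v (γ s₂) := by
  have hl := hB.pos
  have hvL : LipschitzWith P.toNNReal v := by
    refine LipschitzWith.of_dist_le_mul fun x y => ?_
    rw [dist_eq_norm, dist_eq_norm, Real.norm_eq_abs]
    exact (h.abs_sub_le y x).trans (mul_le_mul_of_nonneg_right (Real.le_coe_toNNReal P)
      (norm_nonneg _))
  have hf := hvL.comp_lipschitzOnWith hγ
  have hmono : ∀ s t, 0 ≤ s → s ≤ t → t ≤ τ → v (γ s) ≤ v (γ t) := by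
    intro s t hs hst ht
    have hsub : Icc s t ⊆ Icc 0 τ := Icc_subset_Icc hs ht
    have := (hf.neg.mono hsub).le_of_ae_hasDerivAt_nonpos hst (by
      filter_upwards [ae_restrict_of_ae_restrict_of_subset hsub hinc] with r hr d hd
      obtain ⟨p, hp, hγr⟩ := hr
      have hd' : HasDerivAt (fun t => v (γ t)) (-d) r :=
        hd.neg.congr_of_eventuallyEq (Eventually.of_forall fun t => (neg_neg _).symm)
      have h1 := h.hasDerivAt_comp_eq hγr hd' hp
      have h2 := hB.elliptic (γ r) p
      rw [real_inner_comm] at h2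
      have h3 : 0 ≤ l * ‖p‖ ^ 2 := by positivity
      linarith)
    simpa using this
  refine lt_of_le_of_ne (hmono s₁ s₂ h₁ h₁₂.le h₂) fun heq => ?_
  have hconst : ∀ t ∈ Icc s₁ s₂, v (γ t) = v (γ s₁) := fun t ht =>
    le_antisymm ((hmono t s₂ (h₁.trans ht.1) ht.2 h₂).trans heq.ge)
      (hmono s₁ t h₁ ht.1 (ht.2.trans h₂))
  have hsub : Icc s₁ s₂ ⊆ Icc 0 τ := Icc_subset_Icc h₁ h₂
  have hac : AbsolutelyContinuousOnInterval γ s₁ s₂ := by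
    apply LipschitzOnWith.absolutelyContinuousOnInterval (K := L)
    rw [uIcc_of_le h₁₂.le]
    exact hγ.mono hsub
  obtain ⟨y, hy⟩ := hac.const_of_ae_hasDerivAt_zero (by
    rw [uIcc_of_le h₁₂.le, ← ae_restrict_iff' measurableSet_Icc,
      ← restrict_Ioo_eq_restrict_Icc]
    filter_upwards [ae_restrict_of_ae_restrict_of_subset (Ioo_subset_Icc_self.trans hsub) hinc,
      ae_restrict_mem measurableSet_Ioo] with r hr hmem
    obtain ⟨p, hp, hγr⟩ := hr
    have hd : HasDerivAt (fun t => v (γ t)) 0 r := by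
      refine (hasDerivAt_const r (v (γ s₁))).congr_of_eventuallyEq ?_
      filter_upwards [Ioo_mem_nhds hmem.1 hmem.2] with t ht
      exact hconst t (Ioo_subset_Icc_self ht)
    have h1 := h.hasDerivAt_comp_eq hγr hd hp
    have h2 := hB.elliptic (γ r) p
    rw [real_inner_comm, ← h1] at h2
    have h3 : ‖p‖ ^ 2 ≤ 0 := by
      by_contra hcon
      push Not at hcon
      linarith [mul_pos hl hcon]
    have h4 : p = 0 := by simpa using le_antisymm h3 (sq_nonneg _)
    rw [h4, map_zero] at hγr
    exact hγr)
  rw [uIcc_of_le h₁₂.le] at hy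
  refine hne s₁ ⟨h₁, h₁₂.trans_le h₂⟩ ?_
  refine (hasDerivWithinAt_const s₁ (Ici s₁) y).congr_of_eventuallyEq_of_mem ?_ self_mem_Ici
  filter_upwards [Icc_mem_nhdsGE h₁₂] with t ht
  exact hy t ht

/-- At a singular point, the minimal supergradient has energy strictly below the level `a`, by
strict convexity. -/
theorem minimal_energy_lt_of_mem_singularSet (hB : IsUniformCometric B l K) {V : RSpace n → ℝ}
    {a : ℝ} {x p : RSpace n} (hsub : ∀ p ∈ superdiff v x, 1 / 2 * inner ℝ (B x p) p + V x ≤ a)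
    (hx : x ∈ singularSet v) (hp : p ∈ superdiff v x)
    (hmin : ∀ q ∈ superdiff v x, 0 ≤ inner ℝ (B x p) (q - p)) :
    1 / 2 * inner ℝ (B x p) p + V x < a := by
  obtain ⟨q, hq, hqp⟩ : ∃ q ∈ superdiff v x, q ≠ p := by
    by_contra hcon
    push Not at hcon
    exact hx ⟨p, Subset.antisymm hcon (singleton_subset_iff.2 hp)⟩
  have h1 := hsub q hq
  have h2 := hmin q hq
  have h3 := hB.elliptic x (q - p)
  have h4 : 0 < l * ‖q - p‖ ^ 2 := by
    have := hB.pos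
    have := norm_pos_iff.2 (sub_ne_zero.2 hqp)
    positivity
  have h5 : inner ℝ (B x q) p = inner ℝ (B x p) q := by rw [hB.symm, real_inner_comm]
  simp only [map_sub, inner_sub_left, inner_sub_right, h5] at h2 h3
  linarith

/-- Conversely, a supergradient of energy below `a` makes the point singular: at a point of
differentiability the supersolution property gives energy at least `a`. -/
theorem mem_singularSet_of_energy_lt (h : IsLipschitzSemiconcave v P C) {V : RSpace n → ℝ}
    {a : ℝ} {x p : RSpace n} (hsup : ∀ p ∈ subdiff v x, a ≤ 1 / 2 * inner ℝ (B x p) p + V x)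
    (hp : p ∈ superdiff v x) (hlt : 1 / 2 * inner ℝ (B x p) p + V x < a) :
    x ∈ singularSet v := by
  rintro ⟨q, hq⟩
  have hpq : p = q := by simpa [hq] using hp
  have := hsup q (h.mem_subdiff_of_superdiff_eq_singleton hq)
  rw [← hpq] at this
  linarith

theorem exists_pos_le_norm_subgradient (hB : IsUniformCometric B l K) {V : RSpace n → ℝ}
    (hV : Continuous V) {a : ℝ} {x : RSpace n} (hx : V x < a)
    (hsup : ∀ y, ∀ p ∈ subdiff v y, a ≤ 1 / 2 * inner ℝ (B y p) p + V y) :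
    ∃ ρ > 0, ∀ᶠ y in 𝓝 x, ∀ p ∈ subdiff v y, ρ ≤ ‖p‖ := by
  have hK := hB.nonneg
  have hpos : 0 < (a - V x) / (K + 1) := div_pos (by linarith) (by linarith)
  refine ⟨√((a - V x) / (K + 1)), Real.sqrt_pos.2 hpos, ?_⟩
  filter_upwards [(hV.tendsto x).eventually (gt_mem_nhds (by linarith : V x < (a + V x) / 2))]
    with y hy p hp
  have h1 := hsup y p hp
  have h2 := (le_abs_self _).trans (abs_inner_apply_le (B y) p p)
  have h3 : ‖B y‖ * ‖p‖ * ‖p‖ ≤ K * ‖p‖ * ‖p‖ := by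
    have := hB.norm_le y
    gcongr
  rw [Real.sqrt_le_left (norm_nonneg p), div_le_iff₀ (by linarith)]
  nlinarith [sq_nonneg ‖p‖]

end Propagation

/-! ### Generalized characteristics of the weak KAM solution -/

theorem mainTheorem5 (n : ℕ) (A : RSpace n → Matrix (Fin n) (Fin n) ℝ) (V : RSpace n → ℝ)
    (hA : IsPeriodicMetric A) (hV : IsPeriodicPotential V)
    (c : RSpace n) (a : ℝ) (u : RSpace n → ℝ)
    (hu : IsWeakKAMSolution (mechHamiltonian A V) c a u)
    (henergy : ∀ x, V x < a) :
    (∀ (τ : ℝ) (γ : ℝ → RSpace n),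
      IsGeneralizedCharacteristic (mechHamiltonian A V) (liftedSolution c u) τ γ →
      (∀ s ∈ Ico 0 τ, ¬ HasDerivWithinAt γ 0 (Ici s) s) →
      ∀ s₁ s₂ : ℝ, 0 ≤ s₁ → s₁ < s₂ → s₂ ≤ τ →
        liftedSolution c u (γ s₁) < liftedSolution c u (γ s₂)) ∧
    (∀ x ∈ singularSet (liftedSolution c u),
      ¬ IsLocalMax (liftedSolution c u) x →
      IsLipschitzHypersurfaceNear (levelSet (liftedSolution c u) x) x →
      ∃ (τ' : ℝ) (γ : ℝ → RSpace n), 0 < τ' ∧ γ 0 = x ∧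
        IsGeneralizedCharacteristic (mechHamiltonian A V) (liftedSolution c u) τ' γ ∧
        (∀ s ∈ Icc 0 τ', γ s ∈ singularSet (liftedSolution c u)) ∧
        (∀ s ∈ Ico 0 τ', ∃ w, w ≠ 0 ∧ HasDerivWithinAt γ w (Ici s) s) ∧
        (∃ s ∈ Icc 0 τ', γ s ≠ x)) := by
  obtain ⟨l, K, hB, -⟩ := hA.exists_isUniformCometric hV
  obtain ⟨G, κ, hG⟩ := hA.exists_isDualMetric
  obtain ⟨P, C, h⟩ := hu.exists_isLipschitzSemiconcave hA hV
  set v := liftedSolution c u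
  have hsub : ∀ x, ∀ p ∈ superdiff v x, 1 / 2 * inner ℝ (cometric A x p) p + V x ≤ a :=
    fun x p hp => hu.le_of_mem_superdiff hp
  have hsup : ∀ x, ∀ p ∈ subdiff v x, a ≤ 1 / 2 * inner ℝ (cometric A x p) p + V x :=
    fun x p hp => hu.le_of_mem_subdiff hp
  have hco : ∀ x, closure (convexHull ℝ ((fun p => gradient (mechHamiltonian A V x) p) ''
      superdiff v x)) = cometric A x '' superdiff v x := fun x =>
    hA.closure_convexHull_eq (h.convex_superdiff x) (h.isCompact_superdiff x)
  refine ⟨fun τ γ hγ hne s₁ s₂ h₁ h₁₂ h₂ => ?_, fun x hx hmax hS => ?_⟩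
  · obtain ⟨L, hL⟩ := hγ.lipschitz
    refine h.lt_along_characteristic hB hL ?_ hne h₁ h₁₂ h₂
    filter_upwards [hγ.inclusion] with s hs
    obtain ⟨w, hw, hd⟩ := hs
    rw [hco] at hw
    obtain ⟨p, hp, rfl⟩ := hw
    exact ⟨p, hp, hd⟩
  · obtain ⟨ρ, hρ, hρsub⟩ := exists_pos_le_norm_subgradient hB hV.smooth.continuous (henergy x) hsup
    have h0 := zero_notMem_superdiff h hρ hρsub hmax hS
    obtain ⟨γ, hγ0, hγ⟩ := h.exists_characteristic hB x
    choose q hq hqmin using h.exists_minimal hB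
    have hderiv : ∀ s, 0 ≤ s →
        HasDerivWithinAt γ (cometric A (γ s) (q (γ s))) (Ici s) s := fun s hs =>
      hγ.hasDerivWithinAt hB hG h hs (hq (γ s)) (hqmin (γ s))
    obtain ⟨k, hk⟩ := hγ.exists_energy_le hB hG h (p := fun s => q (γ s))
      (fun s _ => hq (γ s)) hderiv
    simp only [hγ0] at hk
    have hlt := minimal_energy_lt_of_mem_singularSet hB (hsub x) hx (hq x) (hqmin x)
    have hγc : Tendsto γ (𝓝[≥] 0) (𝓝 x) := by
      have := (hderiv 0 le_rfl).continuousWithinAt.tendsto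
      rwa [hγ0] at this
    -- For small times the energy bound stays below the level `a`, and `D⁺v` stays away from `0`.
    have hev1 : ∀ᶠ s in 𝓝[≥] (0 : ℝ),
        1 / 2 * (inner ℝ (cometric A x (q x)) (q x) * Real.exp (k * s)) + V (γ s) < a := by
      have hexp : Tendsto (fun s : ℝ => 1 / 2 * (inner ℝ (cometric A x (q x)) (q x) *
          Real.exp (k * s))) (𝓝[≥] 0) (𝓝 (1 / 2 * inner ℝ (cometric A x (q x)) (q x))) := by
        have hc : Continuous fun s : ℝ => 1 / 2 * (inner ℝ (cometric A x (q x)) (q x) *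
          Real.exp (k * s)) := by fun_prop
        have := (hc.tendsto 0).mono_left (nhdsWithin_le_nhds (s := Ici 0))
        simpa using this
      exact (hexp.add ((hV.smooth.continuous.tendsto x).comp hγc)).eventually (gt_mem_nhds hlt)
    have hev2 : ∀ᶠ s in 𝓝[≥] (0 : ℝ), superdiff v (γ s) ⊆ {0}ᶜ :=
      hγc.eventually (h.eventually_superdiff x isOpen_compl_singleton
        (subset_compl_singleton_iff.2 h0))
    obtain ⟨τ, hτ, hτs⟩ := (mem_nhdsGE_iff_exists_Icc_subset).1 (hev1.and hev2)
    have hτ0 : (0 : ℝ) < τ := hτ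
    have hw : ∀ s ∈ Icc 0 τ, cometric A (γ s) (q (γ s)) ≠ 0 := by
      intro s hs hzero
      have h1 : q (γ s) ≠ 0 := (hτs hs).2 (hq (γ s))
      have h2 := hA.inner_cometric_pos (γ s) h1
      rw [hzero, inner_zero_left] at h2
      exact lt_irrefl _ h2
    refine ⟨τ, γ, hτ0, hγ0, ⟨⟨_, hγ.lipschitzOnWith le_rfl⟩, ?_⟩, fun s hs => ?_,
      fun s hs => ⟨_, hw s (Ico_subset_Icc_self hs), hderiv s hs.1⟩, ?_⟩
    · filter_upwards [(hγ.lipschitzOnWith (b := τ) le_rfl).ae_differentiableAt_Ioo] with s hs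
      have hd := hs.2.hasDerivAt
      exact ⟨_, by rw [hco]; exact hγ.inclusion s hs.1.1.le _ hd, hd⟩
    · refine mem_singularSet_of_energy_lt h (hsup (γ s)) (hq (γ s)) ?_
      have h1 := (hτs hs).1
      have h2 := hk s hs.1
      linarith
    · by_contra hcon
      push Not at hcon
      have hd0 : HasDerivWithinAt γ 0 (Ici 0) 0 := by
        refine (hasDerivWithinAt_const 0 (Ici 0) x).congr_of_eventuallyEq_of_mem ?_ self_mem_Ici
        filter_upwards [Icc_mem_nhdsGE hτ0] with s hs
        exact hcon s hs
      exact hw 0 ⟨le_rfl, hτ0.le⟩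
        ((uniqueDiffOn_Ici 0 0 self_mem_Ici).eq_deriv _ (hderiv 0 le_rfl) hd0)
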